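/- Let $1\le k\le n$ be integers and $K,c_1,c_2\in\mathbb{R}$ with $c_2>0$ and $K^2c_1\le 1$. Let $(M,g)$ be the $n$-dimensional complete simply connected space form of constant sectional curvature $K$ (Euclidean space if $K=0$, hyperbolic space if $K<0$, the sphere of radius $1/\sqrt K$ if $K>0$), let $x_0\in M$ be a base point, and let $r$ be the geodesic distance from $x_0$. In polar coordinates around $x_0$ the metric is $g=dr\otimes dr+f(r)^2g_{\mathbb{S}^{n-1}}$, where $f(r)=r$ for $K=0$, $f(r)=\sinh(\sqrt{-K}\,r)/\sqrt{-K}$ for $K<0$ and $f(r)=\sin(\sqrt{K}\,r)/\sqrt{K}$ for $K>0$. Put $V=f'(r)$, that is, $V=1$ for $K=0$, $V=\cosh(\sqrt{-K}\,r)$ for $K<0$ and $V=\cos(\sqrt K\,r)$ for $K>0$. Let $\Omega\subset M$ be a bounded, open, connected domain with boundary of class $C^2$, contained, if $K>0$, in the open hemisphere $\{r<\pi/(2\sqrt K)\}$. Let $\nu$ be the outward unit normal to $\partial\Omega$ and $d\mu$ the Riemannian volume measure, and for $0\le j\le n$ let $\sigma_j=\sigma_j(\nabla^2u+Kug)$ be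 the $j$-th elementary symmetric function of the eigenvalues of $\nabla^2u+Kug$ with respect to $g$ ($\sigma_0=1$), where $\nabla^2 u$ is the Hessian of $u$. Suppose that $u\in C^3(\Omega)\cap C^2(\overline\Omega)$ satisfies $$\sigma_k(\nabla^2u+Kug)=\binom nk\ \text{ in }\Omega,\qquad u=Kc_1\ \text{ on }\partial\Omega,\qquad u_\nu=c_2\ \text{ on }\partial\Omega,\qquad Ku\ge 0\ \text{ in }\Omega.$$ Then the two integrands below are integrable over $\Omega$ and $$\binom{n}{k-1}\int_\Omega(u-Kc_1)\,V\,d\mu=\frac12\int_\Omega\left(|\nabla u|^2+Ku^2-K^3c_1^2-c_2^2\right)\sigma_{k-1}\,V\,d\mu .$$ -/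

import Mathlib

open MeasureTheory Set Filter Topology

noncomputable section

/-! ### Riemannian geometry in a global coordinate chart

A Riemannian metric on an open subset of `ℝⁿ` is given by its coefficient matrix `G x = (gᵢⱼ(x))`. -/

/-- The `i`-th partial derivative `∂ᵢ F`. -/
def pderiv {n : ℕ} (i : Fin n) (F : EuclideanSpace ℝ (Fin n) → ℝ)
    (x : EuclideanSpace ℝ (Fin n)) : ℝ :=
  fderiv ℝ F x (EuclideanSpace.single i 1)

/-- The Christoffel symbols of the Levi-Civita connection,
`Γˡᵢⱼ = ½ gˡᵐ (∂ᵢ gⱼₘ + ∂ⱼ gᵢₘ - ∂ₘ gᵢⱼ)`. -/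
def christoffel {n : ℕ} (G : EuclideanSpace ℝ (Fin n) → Matrix (Fin n) (Fin n) ℝ)
    (l i j : Fin n) (x : EuclideanSpace ℝ (Fin n)) : ℝ :=
  1 / 2 * ∑ m, (G x)⁻¹ l m *
    (pderiv i (fun y => G y j m) x + pderiv j (fun y => G y i m) x
      - pderiv m (fun y => G y i j) x)

/-- The Riemannian Hessian, `(∇²u)ᵢⱼ = ∂ᵢ∂ⱼu - Γˡᵢⱼ ∂ₗu`. -/
def riemHessian {n : ℕ} (G : EuclideanSpace ℝ (Fin n) → Matrix (Fin n) (Fin n) ℝ)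
    (u : EuclideanSpace ℝ (Fin n) → ℝ) (x : EuclideanSpace ℝ (Fin n)) :
    Matrix (Fin n) (Fin n) ℝ :=
  Matrix.of fun i j => pderiv i (pderiv j u) x - ∑ l, christoffel G l i j x * pderiv l u x

/-- The squared length of the Riemannian gradient, `|∇u|² = gⁱʲ ∂ᵢu ∂ⱼu`. -/
def gradNormSq {n : ℕ} (G : EuclideanSpace ℝ (Fin n) → Matrix (Fin n) (Fin n) ℝ)
    (u : EuclideanSpace ℝ (Fin n) → ℝ) (x : EuclideanSpace ℝ (Fin n)) : ℝ :=
  ∑ i, ∑ j, (G x)⁻¹ i j * pderiv i u x * pderiv j u x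

/-- The inner product `g(v, w) = gᵢⱼ vⁱ wʲ` of two tangent vectors at `x`. -/
def metricInner {n : ℕ} (G : EuclideanSpace ℝ (Fin n) → Matrix (Fin n) (Fin n) ℝ)
    (x v w : EuclideanSpace ℝ (Fin n)) : ℝ :=
  ∑ i, ∑ j, G x i j * v i * w j

/-- The Riemannian volume measure `dμ = √(det g) dx`. -/
def riemVolume {n : ℕ} (G : EuclideanSpace ℝ (Fin n) → Matrix (Fin n) (Fin n) ℝ) :
    Measure (EuclideanSpace ℝ (Fin n)) :=
  volume.withDensity fun x => ENNReal.ofReal (Real.sqrt (G x).det)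

/-- The `k`-th elementary symmetric function of the eigenvalues (with multiplicity) of `A`. -/
def sigmaMat {n : ℕ} (k : ℕ) (A : Matrix (Fin n) (Fin n) ℝ) : ℝ :=
  A.charpoly.roots.esymm k

/-- `σ_k(∇²u + K u g)`: the eigenvalues of the symmetric 2-form `b = ∇²u + K u g` with respect
to the metric `g`, that is, those of the endomorphism `g⁻¹ b`. -/
def sigmaHess {n : ℕ} (G : EuclideanSpace ℝ (Fin n) → Matrix (Fin n) (Fin n) ℝ) (K : ℝ) (k : ℕ)
    (u : EuclideanSpace ℝ (Fin n) → ℝ) (x : EuclideanSpace ℝ (Fin n)) : ℝ :=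
  sigmaMat k ((G x)⁻¹ * (riemHessian G u x + (K * u x) • G x))

/-! ### The space form of curvature `K` -/

/-- The metric of constant sectional curvature `K` in conformal coordinates centred at the base
point, `g = |dx|² / (1 + K|x|²/4)²`. It is Euclidean space for `K = 0`, the Poincaré ball model of
hyperbolic space on `|x| < 2/√(-K)` for `K < 0`, and, for `K > 0`, the sphere of radius `1/√K`
without the antipode of the base point, in stereographic coordinates on all of `ℝⁿ`. -/
def spaceFormMetric {n : ℕ} (K : ℝ) (x : EuclideanSpace ℝ (Fin n)) :
    Matrix (Fin n) (Fin n) ℝ :=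
  ((1 + K * ‖x‖ ^ 2 / 4) ^ 2)⁻¹ • (1 : Matrix (Fin n) (Fin n) ℝ)

/-- The points of `Mⁿ(K)`: the whole model for `K ≤ 0` (all of `ℝⁿ`, or the ball
`|x| < 2/√(-K)`), and the open hemisphere `|x| < 2/√K` around the base point for `K > 0`. -/
def spaceForm (n : ℕ) (K : ℝ) : Set (EuclideanSpace ℝ (Fin n)) :=
  {x | |K| * ‖x‖ ^ 2 < 4}

/-- The geodesic distance `r(x)` from `x` to the base point `0`, the length of the radial
geodesic from `0` to `x`. With `f = warp K` the metric is `dr² + f(r)² g_{𝕊ⁿ⁻¹}`. -/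
def radius {n : ℕ} (K : ℝ) (x : EuclideanSpace ℝ (Fin n)) : ℝ :=
  ∫ s in (0 : ℝ)..‖x‖, (1 + K * s ^ 2 / 4)⁻¹

/-- The warping function `f`. -/
def warp (K r : ℝ) : ℝ :=
  if K = 0 then r
  else if K < 0 then Real.sinh (Real.sqrt (-K) * r) / Real.sqrt (-K)
  else Real.sin (Real.sqrt K * r) / Real.sqrt K

/-- The function `V = f'(r)`. -/
def potentialV {n : ℕ} (K : ℝ) (x : EuclideanSpace ℝ (Fin n)) : ℝ :=
  deriv (warp K) (radius K x)

/-! ### Domains with `C²` boundary -/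

/-- `ψ` is a `C²` defining function of `Ω` near the boundary point `p`. -/
def IsLocalDefiningFunction {n : ℕ} (Ω : Set (EuclideanSpace ℝ (Fin n)))
    (p : EuclideanSpace ℝ (Fin n)) (ψ : EuclideanSpace ℝ (Fin n) → ℝ) : Prop :=
  ContDiffAt ℝ 2 ψ p ∧ fderiv ℝ ψ p ≠ 0 ∧ ∀ᶠ x in 𝓝 p, (x ∈ Ω ↔ ψ x < 0)

/-- The boundary of `Ω` is of class `C²`. -/
def HasC2Boundary {n : ℕ} (Ω : Set (EuclideanSpace ℝ (Fin n))) : Prop :=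
  ∀ p ∈ frontier Ω, ∃ ψ, IsLocalDefiningFunction Ω p ψ

/-- `ν` is the outward unit normal to `∂Ω` at `p`: it has `g`-length one and is a positive multiple
of the `g`-gradient of a local defining function (which is negative inside `Ω`). -/
def IsOutwardUnitNormal {n : ℕ} (G : EuclideanSpace ℝ (Fin n) → Matrix (Fin n) (Fin n) ℝ)
    (Ω : Set (EuclideanSpace ℝ (Fin n))) (p ν : EuclideanSpace ℝ (Fin n)) : Prop :=
  metricInner G p ν ν = 1 ∧
    ∃ ψ, IsLocalDefiningFunction Ω p ψ ∧
      ∃ a : ℝ, 0 < a ∧ ∀ w, fderiv ℝ ψ p w = a * metricInner G p ν w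

end

/-! ### Elementary symmetric functions and Newton tensors of a matrix -/

section NewtonTensor

open Polynomial

variable {ι : Type*} [Fintype ι] [DecidableEq ι]

/-! Write A = g⁻¹(∇²u + K u g), P = |∇u|² + K u², X = f ∂ᵣ, and let Tₘ be the Newton tensors of A.
Shift the index so that the equation reads σₖ₊₁(A) = s, and set c = K c₁, c' = K c² + c₂².

Three facts carry the proof. In a space form A satisfies the Codazzi equation, so every Tₘ is
divergence free (`dHessianField_codazzi`, `sum_pderiv_newtonTensor`). The field X is conformal with
∇X = V · id, hence div(Tₘ X) = V tr Tₘ = (n - m) σₘ V (`sum_pderiv_newtonField`). Finally ∇P = 2 A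
∇u (`hasLineDerivAt_gradient_function`).

Consider W = (P - c') Tₖ X - 2 (u - c) Tₖ A X, where Tₖ A = s - Tₖ₊₁. In div W the terms 2⟨A∇u, Tₖ
X⟩ and 2⟨∇u, Tₖ A X⟩ cancel, which leaves V ((n - k)(P - c') σₖ - 2 (k + 1) s (u - c))
(`sum_pderiv_boundaryField`). The boundary data say that u = c and |∇u|² = c₂² on ∂Ω, so both
coefficients u - c and P - c' vanish there and ∫ div W = 0. With s = C(n, k+1), the relation (k + 1)
C(n, k+1) = (n - k) C(n, k) gives the identity after division by n - k.

The divergence theorem needs no boundary integral: W is cut off where w = (u - c)² + (P - c')² is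
small. Both ∇w and W are linear in the two coefficients, so the error |∇w · W| is O(w), exactly what
the cutoff tolerates. The divergence of W contains no third derivatives of u, so it stays bounded
although u is only C² up to ∂Ω.

All computations are made in conformal coordinates, where g = q⁻² |dx|² with q = 1 + K|x|²/4, X has
components xⁱ, and V = (1 - K|x|²/4)/q. -/

/-- The coefficient of `X ^ m` in `det (1 + X A)`. -/
noncomputable def elemSymm (m : ℕ) (A : Matrix ι ι ℝ) : ℝ := (-1) ^ m * A.charpolyRev.coeff m

/-- The Newton tensors `T₀ = 1`, `Tₘ₊₁ = σₘ₊₁ - A Tₘ`. -/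
noncomputable def newtonTensor : ℕ → Matrix ι ι ℝ → Matrix ι ι ℝ
  | 0, _ => 1
  | m + 1, A => elemSymm (m + 1) A • (1 : Matrix ι ι ℝ) - A * newtonTensor m A

/-- The coefficient of `X ^ m` in the adjugate of `1 - X A`. -/
noncomputable def adjCoeff (m : ℕ) (A : Matrix ι ι ℝ) : Matrix ι ι ℝ :=
  Matrix.of fun i j => ((1 - (X : ℝ[X]) • A.map C).adjugate i j).coeff m

/-- Jacobi's formula for the derivative of the determinant along a curve. -/
theorem hasDerivAt_det {M : ℝ → Matrix ι ι ℝ} {M' : Matrix ι ι ℝ} {t : ℝ}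
    (h : ∀ i j, HasDerivAt (fun s => M s i j) (M' i j) t) :
    HasDerivAt (fun s => (M s).det) (((M t).adjugate * M').trace) t := by
  -- By Cramer's rule the trace is the sum of the determinants with one column differentiated; the
  -- product rule in the Leibniz expansion gives the same sum.
  have h1 : ((M t).adjugate * M').trace = ∑ i, ((M t).updateCol i (fun r => M' r i)).det := by
    simp only [Matrix.trace, Matrix.diag_apply]
    refine Finset.sum_congr rfl fun i _ => ?_
    rw [← Matrix.cramer_apply, Matrix.cramer_eq_adjugate_mulVec]
    rfl
  have h2 : ∀ i, ((M t).updateCol i (fun r => M' r i)).det =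
      ∑ σ : Equiv.Perm ι, (Equiv.Perm.sign σ : ℝ) *
        ((∏ j ∈ Finset.univ.erase i, M t (σ j) j) * M' (σ i) i) := by
    intro i
    rw [Matrix.det_apply']
    refine Finset.sum_congr rfl fun σ _ => ?_
    rw [← Finset.prod_erase_mul _ _ (Finset.mem_univ i)]
    congr 2
    · refine Finset.prod_congr rfl fun j hj => ?_
      rw [Matrix.updateCol_ne (Finset.ne_of_mem_erase hj)]
    · simp
  rw [h1]
  simp only [h2, Matrix.det_apply']
  rw [Finset.sum_comm]
  refine HasDerivAt.fun_sum fun σ _ => ?_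
  rw [← Finset.mul_sum]
  refine HasDerivAt.const_mul _ ?_
  simpa [smul_eq_mul] using HasDerivAt.fun_finsetProd (u := Finset.univ)
    (f := fun j s => M s (σ j) j) (fun j _ => h (σ j) j)

theorem eval_one_sub_X_smul (A : Matrix ι ι ℝ) (t : ℝ) :
    (1 - (X : ℝ[X]) • A.map C).map (eval t) = 1 - t • A := by
  ext i j
  simp [Matrix.one_apply, apply_ite (eval t)]
  ring

theorem eval_charpolyRev_eq (A : Matrix ι ι ℝ) (t : ℝ) :
    A.charpolyRev.eval t = (1 - t • A).det := by
  rw [Matrix.charpolyRev, ← eval_one_sub_X_smul, ← coe_evalRingHom, RingHom.map_det]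
  rfl

theorem eval_adjugate_one_sub_X_smul (A : Matrix ι ι ℝ) (t : ℝ) (i j : ι) :
    ((1 - (X : ℝ[X]) • A.map C).adjugate i j).eval t = (1 - t • A).adjugate i j := by
  rw [← eval_one_sub_X_smul, ← coe_evalRingHom]
  change _ = ((evalRingHom t).mapMatrix _).adjugate i j
  rw [← RingHom.map_adjugate]
  rfl

/-- Compare coefficients of X in (1 - XA) adj(1 - XA) = det(1 - XA) · 1. -/
theorem adjCoeff_recursion (A : Matrix ι ι ℝ) :
    adjCoeff 0 A = 1 ∧
    ∀ m, adjCoeff (m + 1) A = A.charpolyRev.coeff (m + 1) • (1 : Matrix ι ι ℝ) + A * adjCoeff m A := by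
  have key := Matrix.mul_adjugate (1 - (X : ℝ[X]) • A.map C)
  have hij : ∀ i j, (1 - (X : ℝ[X]) • A.map C).adjugate i j =
      A.charpolyRev * C ((1 : Matrix ι ι ℝ) i j) +
        X * ∑ l, C (A i l) * (1 - (X : ℝ[X]) • A.map C).adjugate l j := by
    intro i j
    have := congrFun (congrFun key i) j
    rw [sub_mul, one_mul, Matrix.sub_apply, Matrix.smul_mul, Matrix.smul_apply,
      Matrix.mul_apply] at this
    simp only [Matrix.smul_apply, smul_eq_mul, Matrix.map_apply] at this
    rw [sub_eq_iff_eq_add] at this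
    rw [this, Matrix.charpolyRev]
    by_cases h : i = j <;> simp [h, Matrix.one_apply]
  constructor
  · ext i j
    rw [adjCoeff, Matrix.of_apply, hij]
    simp [Polynomial.coeff_zero_eq_eval_zero]
  · intro m
    ext i j
    rw [adjCoeff, Matrix.of_apply, hij]
    simp [coeff_X_mul, Matrix.mul_apply, adjCoeff]

/-- Both sides obey the same recursion up to sign. Through this, Jacobi's formula for det(1 - tA)
becomes a formula with Newton tensors. -/
theorem newtonTensor_eq_adjCoeff (A : Matrix ι ι ℝ) (m : ℕ) :
    newtonTensor m A = ((-1 : ℝ) ^ m) • adjCoeff m A := by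
  induction m with
  | zero => simp [newtonTensor, (adjCoeff_recursion A).1]
  | succ m ih =>
    rw [newtonTensor, ih, (adjCoeff_recursion A).2, elemSymm, pow_succ, Matrix.mul_smul]
    module

@[simp] theorem elemSymm_zero (A : Matrix ι ι ℝ) : elemSymm 0 A = 1 := by
  simp [elemSymm, Polynomial.coeff_zero_eq_eval_zero]

/-- Newton's identity `(m + 1) σₘ₊₁ = tr (Tₘ A)`. -/
theorem succ_mul_elemSymm (A : Matrix ι ι ℝ) (m : ℕ) :
    (m + 1 : ℝ) * elemSymm (m + 1) A = (newtonTensor m A * A).trace := by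
  -- Jacobi's formula for t ↦ det(1 - tA), valid at every t and hence an identity of polynomials.
  -- Newton's identity is its coefficient at `X ^ m`.
  have h : derivative A.charpolyRev =
      -∑ i, ∑ l, (1 - (X : ℝ[X]) • A.map C).adjugate i l * C (A l i) := by
    refine Polynomial.funext fun t => ?_
    have h1 := A.charpolyRev.hasDerivAt t
    have h2 := hasDerivAt_det (M := fun t => 1 - t • A) (M' := -A) (t := t) fun i j => by
      simpa using ((hasDerivAt_id t).mul_const (A i j)).const_sub ((1 : Matrix ι ι ℝ) i j)
    simp only [← eval_charpolyRev_eq] at h2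
    rw [h1.unique h2]
    simp [Matrix.trace, Matrix.mul_apply, eval_finsetSum, eval_adjugate_one_sub_X_smul]
  have h3 := congrArg (fun p => p.coeff m) h
  simp only [coeff_derivative, coeff_neg, finsetSum_coeff, coeff_mul_C] at h3
  rw [newtonTensor_eq_adjCoeff, Matrix.smul_mul, Matrix.trace_smul, smul_eq_mul, elemSymm, pow_succ]
  have h4 : (adjCoeff m A * A).trace = -(A.charpolyRev.coeff (m + 1) * (m + 1)) := by
    rw [h3]
    simp [Matrix.trace, Matrix.mul_apply, adjCoeff]
  rw [h4]
  ring

theorem elemSymm_succ (A : Matrix ι ι ℝ) (m : ℕ) :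
    elemSymm (m + 1) A = (m + 1 : ℝ)⁻¹ * (newtonTensor m A * A).trace := by
  rw [← succ_mul_elemSymm, inv_mul_cancel_left₀ (by positivity)]

theorem newtonTensor_commute (A : Matrix ι ι ℝ) (m : ℕ) :
    newtonTensor m A * A = A * newtonTensor m A := by
  induction m with
  | zero => simp [newtonTensor]
  | succ m ih => rw [newtonTensor, sub_mul, mul_sub, mul_assoc, ih]; simp

theorem newtonTensor_mul_self (A : Matrix ι ι ℝ) (m : ℕ) :
    newtonTensor m A * A = elemSymm (m + 1) A • (1 : Matrix ι ι ℝ) - newtonTensor (m + 1) A := by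
  rw [newtonTensor_commute, newtonTensor]; abel

theorem trace_newtonTensor (A : Matrix ι ι ℝ) (m : ℕ) :
    (newtonTensor m A).trace = (Fintype.card ι - m : ℝ) * elemSymm m A := by
  cases m with
  | zero => simp [newtonTensor]
  | succ m =>
    rw [newtonTensor, ← newtonTensor_commute, Matrix.trace_sub, ← succ_mul_elemSymm]
    simp
    ring

theorem newtonTensor_transpose {A : Matrix ι ι ℝ} (hA : A.transpose = A) (m : ℕ) :
    (newtonTensor m A).transpose = newtonTensor m A := by
  induction m with
  | zero => simp [newtonTensor]
  | succ m ih => simp [newtonTensor, Matrix.transpose_mul, ih, hA, newtonTensor_commute]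

section Smooth

variable {E : Type*} [NormedAddCommGroup E] [NormedSpace ℝ E] {s : Set E} {N : WithTop ℕ∞}
  {A : E → Matrix ι ι ℝ}

/-- The recursion for Tₘ together with `elemSymm_succ` builds both families from the entries by sums
and products, so one joint induction suffices. The case N = 0 later gives continuity up to the
boundary. -/
theorem contDiffOn_elemSymm_newtonTensor (hA : ∀ i j, ContDiffOn ℝ N (fun x => A x i j) s) (m : ℕ) :
    ContDiffOn ℝ N (fun x => elemSymm m (A x)) s ∧
      ∀ i j, ContDiffOn ℝ N (fun x => newtonTensor m (A x) i j) s := by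
  induction m with
  | zero => simp [newtonTensor, contDiffOn_const]
  | succ m ih =>
    have h1 : ContDiffOn ℝ N (fun x => elemSymm (m + 1) (A x)) s := by
      simp only [elemSymm_succ, Matrix.trace, Matrix.diag_apply, Matrix.mul_apply]
      exact contDiffOn_const.mul (ContDiffOn.sum fun i _ => ContDiffOn.sum fun l _ =>
        (ih.2 _ _).mul (hA _ _))
    refine ⟨h1, fun i j => ?_⟩
    simp only [newtonTensor, Matrix.sub_apply, Matrix.smul_apply, Matrix.mul_apply, smul_eq_mul]
    exact (h1.mul contDiffOn_const).sub (ContDiffOn.sum fun l _ => (hA _ _).mul (ih.2 _ _))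

end Smooth

/-- The derivative of `σₘ₊₁` is `tr (Tₘ dA)`. -/
theorem hasDerivAt_elemSymm {A : ℝ → Matrix ι ι ℝ} {A' : Matrix ι ι ℝ} {s : ℝ}
    (h : ∀ i j, HasDerivAt (fun r => A r i j) (A' i j) s)
    (hs : ∀ m, DifferentiableAt ℝ (fun r => elemSymm m (A r)) s) (m : ℕ) :
    HasDerivAt (fun r => elemSymm (m + 1) (A r)) ((newtonTensor m (A s) * A').trace) s := by
  have hc : ∀ m, DifferentiableAt ℝ (fun r => (A r).charpolyRev.coeff m) s := fun m => by
    refine ((hs m).const_mul ((-1) ^ m)).congr_of_eventuallyEq (Eventually.of_forall fun r => ?_)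
    simp only [elemSymm, ← mul_assoc, ← mul_pow]; simp
  set c' : ℕ → ℝ := fun m => deriv (fun r => (A r).charpolyRev.coeff m) s with hc'
  have hdeg : ∀ B : Matrix ι ι ℝ, B.charpolyRev.natDegree < Fintype.card ι + 1 := fun B => by
    rw [← Matrix.reverse_charpoly]
    exact Nat.lt_succ_of_le ((reverse_natDegree_le _).trans (Matrix.charpoly_natDegree_eq_dim B).le)
  -- For each fixed t, det(1 - tA(r)) is differentiated in r in two ways: coefficientwise and by
  -- Jacobi's formula. Agreement at all t allows coefficients to be compared.
  have hpoly : ∑ m ∈ Finset.range (Fintype.card ι + 1), C (c' m) * X ^ m =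
      -(X * ∑ i, ∑ l, (1 - (X : ℝ[X]) • (A s).map C).adjugate i l * C (A' l i)) := by
    refine Polynomial.funext fun t => ?_
    have h1 : HasDerivAt (fun r => (A r).charpolyRev.eval t)
        (∑ m ∈ Finset.range (Fintype.card ι + 1), c' m * t ^ m) s := by
      simp only [fun r => eval_eq_sum_range' (hdeg (A r)) t]
      exact HasDerivAt.fun_sum fun m _ => ((hc m).hasDerivAt).mul_const _
    have h2 := hasDerivAt_det (M := fun r => 1 - t • A r) (M' := -(t • A')) (t := s) fun i j => by
      simpa using ((h i j).const_mul t).const_sub ((1 : Matrix ι ι ℝ) i j)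
    simp only [← eval_charpolyRev_eq] at h2
    have := h1.unique h2
    simp only [eval_finsetSum, eval_mul, eval_C, eval_pow, eval_X, eval_neg,
      eval_adjugate_one_sub_X_smul]
    rw [this]
    simp [Matrix.trace, Matrix.mul_apply, Finset.mul_sum]
  have h3 := congrArg (fun p => p.coeff (m + 1)) hpoly
  simp only [coeff_neg, coeff_X_mul, finsetSum_coeff, coeff_mul_C, coeff_C_mul, coeff_X_pow] at h3
  have h4 : c' (m + 1) = -(adjCoeff m (A s) * A').trace := by
    have : (adjCoeff m (A s) * A').trace = ∑ i, ∑ l,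
        ((1 - (X : ℝ[X]) • (A s).map C).adjugate i l).coeff m * A' l i := by
      simp [Matrix.trace, Matrix.mul_apply, adjCoeff]
    rw [this, ← h3]
    -- Above the degree bound the coefficient is identically zero, so its derivative is zero, in
    -- agreement with the empty sum.
    by_cases hm : m + 1 < Fintype.card ι + 1
    · simp [Finset.sum_ite_eq, hm]
    · have : ∀ r, (A r).charpolyRev.coeff (m + 1) = 0 := fun r =>
        coeff_eq_zero_of_natDegree_lt (by have := hdeg (A r); omega)
      simp only [hc', this, deriv_const]
      simp [hm]
  have h5 := ((hc (m + 1)).hasDerivAt).const_mul ((-1) ^ (m + 1))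
  rw [newtonTensor_eq_adjCoeff, Matrix.smul_mul, Matrix.trace_smul, smul_eq_mul]
  refine h5.congr_deriv ?_
  change (-1) ^ (m + 1) * c' (m + 1) = _
  rw [h4]; ring

/-- A real symmetric matrix has a characteristic polynomial that splits over ℝ, so its root multiset
has all n eigenvalues and Vieta's formula applies; `charpolyRev` is the reversed polynomial. -/
theorem sigmaMat_eq_elemSymm {n m : ℕ} (hm : m ≤ n) {A : Matrix (Fin n) (Fin n) ℝ}
    (hA : A.transpose = A) : sigmaMat m A = elemSymm m A := by
  have hH : A.IsHermitian := by rw [Matrix.IsHermitian, Matrix.conjTranspose_eq_transpose_of_trivial, hA]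
  have hn : A.charpoly.natDegree = n := by simp
  have h1 := coeff_eq_esymm_roots_of_splits hH.splits_charpoly (k := n - m) (by omega)
  rw [hn, (Matrix.charpoly_monic A).leadingCoeff, one_mul, Nat.sub_sub_self hm] at h1
  rw [sigmaMat, elemSymm, ← Matrix.reverse_charpoly, coeff_reverse, hn, revAt_le hm, h1,
    ← mul_assoc, ← mul_pow]
  simp

end NewtonTensor

/-! ### The space form in conformal coordinates -/

section SpaceForm

variable {n : ℕ} {K : ℝ} {x : EuclideanSpace ℝ (Fin n)}

/-- The inverse `1 + K|x|²/4` of the conformal factor. -/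
noncomputable def confDen (K : ℝ) (x : EuclideanSpace ℝ (Fin n)) : ℝ := 1 + K * ‖x‖ ^ 2 / 4

theorem contDiff_confDen {N : WithTop ℕ∞} :
    ContDiff ℝ N (confDen K : EuclideanSpace ℝ (Fin n) → ℝ) :=
  contDiff_const.add ((contDiff_const.mul (contDiff_norm_sq ℝ)).div_const 4)

theorem confDen_pos (hx : x ∈ spaceForm n K) : 0 < confDen K x := by
  have h : |K| * ‖x‖ ^ 2 < 4 := hx
  have := mul_le_mul_of_nonneg_right (neg_abs_le K) (sq_nonneg ‖x‖)
  unfold confDen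
  linarith

/-- With a = √(-K), integrating by partial fractions gives tanh(a r/2) = a|x|/2 =: t, and cosh(a r)
= (1 + t²)/(1 - t²). -/
theorem cosh_sqrt_neg_mul_radius (hK : K < 0) (hx : x ∈ spaceForm n K) :
    Real.cosh (Real.sqrt (-K) * radius K x) = (1 - K * ‖x‖ ^ 2 / 4) / confDen K x := by
  have h : |K| * ‖x‖ ^ 2 < 4 := hx
  obtain ⟨a, ha, haK⟩ : ∃ a, 0 < a ∧ Real.sqrt (-K) = a :=
    ⟨_, Real.sqrt_pos.2 (by linarith), rfl⟩
  have ha2 : K = -a ^ 2 := by rw [← haK, Real.sq_sqrt (by linarith)]; ring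
  rw [haK, confDen]
  subst ha2
  rw [abs_neg, abs_of_pos (by positivity)] at h
  set ρ := ‖x‖ with hρ
  have hρ0 : 0 ≤ ρ := norm_nonneg x
  have hρ2 : a * ρ < 2 := by nlinarith [mul_nonneg ha.le hρ0]
  have hlt : ∀ s ∈ uIcc 0 ρ, 0 < 1 + a * s / 2 ∧ 0 < 1 - a * s / 2 := by
    intro s hs
    rw [uIcc_of_le hρ0] at hs
    have h1 := mul_nonneg ha.le hs.1
    have h2 := mul_le_mul_of_nonneg_left hs.2 ha.le
    constructor <;> linarith
  have hr : radius (-a ^ 2) x =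
      (Real.log (1 + a * ρ / 2) - Real.log (1 - a * ρ / 2)) / a := by
    rw [radius, intervalIntegral.integral_eq_sub_of_hasDerivAt
      (f := fun s => (Real.log (1 + a * s / 2) - Real.log (1 - a * s / 2)) / a)]
    · simp [hρ]
    · intro s hs
      obtain ⟨h1, h2⟩ := hlt s hs
      have e1 : HasDerivAt (fun s : ℝ => 1 + a * s / 2) (a / 2) s := by
        simpa using (((hasDerivAt_id s).const_mul a).div_const 2).const_add 1
      have e2 : HasDerivAt (fun s : ℝ => 1 - a * s / 2) (-(a / 2)) s := by
        simpa using (((hasDerivAt_id s).const_mul a).div_const 2).const_sub 1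
      refine (((e1.log h1.ne').sub (e2.log h2.ne')).div_const a).congr_deriv ?_
      have h3 : 1 + -a ^ 2 * s ^ 2 / 4 = (1 + a * s / 2) * (1 - a * s / 2) := by ring
      have h4 : (1 + a * s / 2) + (1 - a * s / 2) = 2 := by ring
      rw [h3]
      generalize 1 + a * s / 2 = p at *
      generalize 1 - a * s / 2 = q at *
      field_simp
      linarith
    · refine ContinuousOn.intervalIntegrable ?_
      refine ContinuousOn.inv₀ (by fun_prop) fun s hs => ?_
      obtain ⟨h1, h2⟩ := hlt s hs
      have h3 : 1 + -a ^ 2 * s ^ 2 / 4 = (1 + a * s / 2) * (1 - a * s / 2) := by ring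
      rw [h3]
      positivity
  obtain ⟨h1, h2⟩ := hlt ρ right_mem_uIcc
  rw [hr, mul_div_cancel₀ _ ha.ne', Real.cosh_eq, neg_sub, Real.exp_sub, Real.exp_sub,
    Real.exp_log h1, Real.exp_log h2]
  have h3 : 1 + -a ^ 2 * ρ ^ 2 / 4 = (1 + a * ρ / 2) * (1 - a * ρ / 2) := by ring
  rw [h3]
  field_simp
  ring

/-- With a = √K the radius integral is an arctangent, so tan(a r/2) = a|x|/2 =: t, and cos(a r) = (1
- t²)/(1 + t²). -/
theorem cos_sqrt_mul_radius (hK : 0 < K) :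
    Real.cos (Real.sqrt K * radius K x) = (1 - K * ‖x‖ ^ 2 / 4) / confDen K x := by
  obtain ⟨a, ha, haK⟩ : ∃ a, 0 < a ∧ Real.sqrt K = a := ⟨_, Real.sqrt_pos.2 hK, rfl⟩
  have ha2 : K = a ^ 2 := by rw [← haK, Real.sq_sqrt hK.le]
  rw [haK, confDen]
  subst ha2
  set ρ := ‖x‖ with hρ
  have hr : radius (a ^ 2) x = 2 / a * Real.arctan (a * ρ / 2) := by
    rw [radius, intervalIntegral.integral_eq_sub_of_hasDerivAt
      (f := fun s => 2 / a * Real.arctan (a * s / 2))]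
    · simp [hρ]
    · intro s _
      have e1 : HasDerivAt (fun s : ℝ => a * s / 2) (a / 2) s := by
        simpa using (((hasDerivAt_id s).const_mul a).div_const 2)
      refine ((e1.arctan).const_mul (2 / a)).congr_deriv ?_
      field_simp
      ring
    · refine ContinuousOn.intervalIntegrable ?_
      exact ContinuousOn.inv₀ (by fun_prop) fun s hs => by positivity
  have h2 : a * (2 / a * Real.arctan (a * ρ / 2)) = 2 * Real.arctan (a * ρ / 2) := by
    field_simp
  rw [hr, h2, Real.cos_two_mul, Real.cos_sq_arctan]
  field_simp
  ring

theorem potentialV_eq (hx : x ∈ spaceForm n K) :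
    potentialV K x = (1 - K * ‖x‖ ^ 2 / 4) / confDen K x := by
  rcases lt_trichotomy K 0 with hK | hK | hK
  · have ha : Real.sqrt (-K) ≠ 0 := (Real.sqrt_pos.2 (by linarith)).ne'
    have hw : warp K = fun r => Real.sinh (Real.sqrt (-K) * r) / Real.sqrt (-K) := by
      funext r; simp [warp, hK, hK.ne]
    have hd : HasDerivAt (warp K) (Real.cosh (Real.sqrt (-K) * radius K x)) (radius K x) := by
      rw [hw]
      refine ((((hasDerivAt_id (radius K x)).const_mul (Real.sqrt (-K))).sinh).div_const
        _).congr_deriv ?_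
      simp [ha]
    rw [potentialV, hd.deriv, cosh_sqrt_neg_mul_radius hK hx]
  · subst hK
    have hw : warp 0 = id := by funext r; simp [warp]
    simp [potentialV, hw, confDen]
  · have ha : Real.sqrt K ≠ 0 := (Real.sqrt_pos.2 hK).ne'
    have hw : warp K = fun r => Real.sin (Real.sqrt K * r) / Real.sqrt K := by
      funext r; simp [warp, hK.not_gt, hK.ne']
    have hd : HasDerivAt (warp K) (Real.cos (Real.sqrt K * radius K x)) (radius K x) := by
      rw [hw]
      refine ((((hasDerivAt_id (radius K x)).const_mul (Real.sqrt K)).sin).div_const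
        _).congr_deriv ?_
      simp [ha]
    rw [potentialV, hd.deriv, cos_sqrt_mul_radius hK]

theorem radius_nonneg (hx : x ∈ spaceForm n K) : 0 ≤ radius K x := by
  refine intervalIntegral.integral_nonneg (norm_nonneg x) fun s hs => inv_nonneg.2 ?_
  have h : |K| * ‖x‖ ^ 2 < 4 := hx
  have h1 := mul_le_mul_of_nonneg_right (neg_abs_le K) (sq_nonneg s)
  have h2 : |K| * s ^ 2 ≤ |K| * ‖x‖ ^ 2 :=
    mul_le_mul_of_nonneg_left (pow_le_pow_left₀ hs.1 hs.2 2) (abs_nonneg K)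
  linarith

/-- On a bounded subset of the space form the conformal factor is bounded. -/
theorem exists_pos_le_confDen {Ω : Set (EuclideanSpace ℝ (Fin n))} (hΩ : Ω ⊆ spaceForm n K)
    (hb : ∃ R : ℝ, ∀ x ∈ Ω, radius K x ≤ R) : ∃ c > 0, ∀ x ∈ closure Ω, c ≤ confDen K x := by
  suffices h : ∃ c > 0, ∀ x ∈ Ω, c ≤ confDen K x by
    obtain ⟨c, hc, h⟩ := h
    exact ⟨c, hc, closure_minimal h
      (isClosed_le continuous_const (contDiff_confDen (N := 0)).continuous)⟩
  rcases lt_or_ge K 0 with hK | hK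
  · obtain ⟨R, hR⟩ := hb
    -- For K < 0 one has 1/q ≤ (1 - K|x|²/4)/q = cosh(√(-K) r) ≤ cosh(√(-K) R): a bounded domain
    -- stays away from the ideal boundary.
    refine ⟨(Real.cosh (Real.sqrt (-K) * R))⁻¹, inv_pos.2 (Real.cosh_pos _), fun x hx => ?_⟩
    have h1 := cosh_sqrt_neg_mul_radius hK (hΩ hx)
    have hq := confDen_pos (hΩ hx)
    have hr := radius_nonneg (hΩ hx)
    have h2 : Real.cosh (Real.sqrt (-K) * radius K x) ≤ Real.cosh (Real.sqrt (-K) * R) := by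
      rw [Real.cosh_le_cosh, abs_of_nonneg (by positivity),
        abs_of_nonneg (mul_nonneg (Real.sqrt_nonneg _) (hr.trans (hR x hx)))]
      exact mul_le_mul_of_nonneg_left (hR x hx) (Real.sqrt_nonneg _)
    rw [h1] at h2
    refine inv_le_of_inv_le₀ hq (le_trans ?_ h2)
    rw [← one_div]
    gcongr
    nlinarith [sq_nonneg ‖x‖]
  · refine ⟨1, one_pos, fun x _ => ?_⟩
    unfold confDen
    have : 0 ≤ K * ‖x‖ ^ 2 / 4 := by positivity
    linarith

theorem isBounded_of_radius_le {Ω : Set (EuclideanSpace ℝ (Fin n))} (hΩ : Ω ⊆ spaceForm n K)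
    (hb : ∃ R : ℝ, ∀ x ∈ Ω, radius K x ≤ R) : Bornology.IsBounded Ω := by
  rw [isBounded_iff_forall_norm_le]
  rcases eq_or_ne K 0 with rfl | hK
  · obtain ⟨R, hR⟩ := hb
    exact ⟨R, fun x hx => by simpa [radius] using hR x hx⟩
  · refine ⟨Real.sqrt (4 / |K|), fun x hx => Real.le_sqrt_of_sq_le ?_⟩
    have h : |K| * ‖x‖ ^ 2 < 4 := hΩ hx
    rw [le_div_iff₀ (abs_pos.2 hK)]
    linarith

theorem spaceFormMetric_eq : spaceFormMetric K x = (confDen K x ^ 2)⁻¹ • (1 : Matrix (Fin n) (Fin n) ℝ) :=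
  rfl

theorem spaceFormMetric_inv (hq : confDen K x ≠ 0) :
    (spaceFormMetric K x)⁻¹ = confDen K x ^ 2 • (1 : Matrix (Fin n) (Fin n) ℝ) := by
  refine Matrix.inv_eq_right_inv ?_
  rw [spaceFormMetric_eq, Matrix.smul_mul, Matrix.mul_smul, smul_smul,
    inv_mul_cancel₀ (pow_ne_zero 2 hq)]
  simp

theorem sqrt_det_spaceFormMetric (hq : 0 < confDen K x) :
    Real.sqrt (spaceFormMetric K x).det = (confDen K x)⁻¹ ^ n := by
  rw [spaceFormMetric_eq, Matrix.det_smul, Matrix.det_one, mul_one, Fintype.card_fin,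
    ← inv_pow, ← pow_mul, mul_comm 2 n, pow_mul, Real.sqrt_sq (by positivity)]

theorem metricInner_spaceForm (v w : EuclideanSpace ℝ (Fin n)) :
    metricInner (spaceFormMetric K) x v w = (confDen K x ^ 2)⁻¹ * ∑ i, v i * w i := by
  simp [metricInner, spaceFormMetric_eq, Matrix.one_apply, Finset.mul_sum, mul_assoc]

theorem gradNormSq_spaceForm (hq : confDen K x ≠ 0) (u : EuclideanSpace ℝ (Fin n) → ℝ) :
    gradNormSq (spaceFormMetric K) u x = confDen K x ^ 2 * ∑ i, pderiv i u x ^ 2 := by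
  simp [gradNormSq, spaceFormMetric_inv hq, Matrix.one_apply, Finset.mul_sum, mul_assoc, sq]

end SpaceForm

/-! ### Coordinate derivatives computed along lines -/

section PartialDerivatives

variable {n : ℕ} {x : EuclideanSpace ℝ (Fin n)} {F : EuclideanSpace ℝ (Fin n) → ℝ} {i j : Fin n}

theorem DifferentiableAt.hasLineDerivAt_pderiv (h : DifferentiableAt ℝ F x) (i : Fin n) :
    HasLineDerivAt ℝ F (pderiv i F x) x (EuclideanSpace.single i 1) :=
  h.hasFDerivAt.hasLineDerivAt _

/-- Once differentiability is known, a partial derivative can be computed by one-variable calculus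
along a coordinate line; all later product-rule computations use this. -/
theorem HasLineDerivAt.pderiv_eq {c : ℝ} (h : HasLineDerivAt ℝ F c x (EuclideanSpace.single i 1))
    (hF : DifferentiableAt ℝ F x) : pderiv i F x = c :=
  (hF.hasLineDerivAt_pderiv i).unique h

theorem hasLineDerivAt_coord (i j : Fin n) :
    HasLineDerivAt ℝ (fun y : EuclideanSpace ℝ (Fin n) => y j) ((1 : Matrix (Fin n) (Fin n) ℝ) i j) x
      (EuclideanSpace.single i 1) := by
  have := (EuclideanSpace.proj j : EuclideanSpace ℝ (Fin n) →L[ℝ] ℝ).hasFDerivAt (x := x)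
  have h := this.hasLineDerivAt (EuclideanSpace.single i 1)
  simpa [Matrix.one_apply, Pi.single_apply, eq_comm] using h

theorem hasLineDerivAt_confDen {K : ℝ} (i : Fin n) :
    HasLineDerivAt ℝ (confDen K) (K * x i / 2) x (EuclideanSpace.single i 1) := by
  have h := ((((hasStrictFDerivAt_norm_sq x).hasFDerivAt.const_mul K).mul_const
    (1 / 4 : ℝ)).const_add 1).hasLineDerivAt (EuclideanSpace.single i 1)
  simp only [mul_one_div] at h
  refine HasDerivAt.congr_deriv h ?_
  simp [EuclideanSpace.inner_single_right]
  ring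

theorem differentiableAt_confDen {K : ℝ} : DifferentiableAt ℝ (confDen K) x :=
  (contDiff_confDen (N := 1)).differentiable one_ne_zero x

theorem contDiffAt_pderiv {m : WithTop ℕ∞} (h : ContDiffAt ℝ (m + 1) F x) (i : Fin n) :
    ContDiffAt ℝ m (pderiv i F) x :=
  (h.fderiv_right le_rfl).clm_apply contDiffAt_const

theorem pderiv_comm (h : ContDiffAt ℝ 2 F x) (i j : Fin n) :
    pderiv i (pderiv j F) x = pderiv j (pderiv i F) x := by
  have hd : DifferentiableAt ℝ (fderiv ℝ F) x :=
    (h.fderiv_right (m := 1) (by norm_num)).differentiableAt one_ne_zero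
  have key : ∀ a b : Fin n, pderiv a (pderiv b F) x =
      fderiv ℝ (fderiv ℝ F) x (EuclideanSpace.single a 1) (EuclideanSpace.single b 1) := by
    intro a b
    have := hd.hasFDerivAt.clm_apply (hasFDerivAt_const (EuclideanSpace.single b (1 : ℝ)) x)
    unfold pderiv
    rw [this.fderiv]
    simp
  rw [key, key]
  exact (h.isSymmSndFDerivAt (by simp)).eq _ _

end PartialDerivatives

/-! ### The divergence theorem for vector fields vanishing on the boundary -/

section Divergence

variable {n : ℕ}

/-- Integration by parts against the constant function 1. -/
theorem integral_pderiv_eq_zero {F : EuclideanSpace ℝ (Fin n) → ℝ} (hF : ContDiff ℝ 1 F)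
    (hc : HasCompactSupport F) (i : Fin n) : ∫ x, pderiv i F x = 0 := by
  have hd : Continuous (fun x => fderiv ℝ F x (EuclideanSpace.single i (1 : ℝ))) :=
    (hF.continuous_fderiv one_ne_zero).clm_apply continuous_const
  have h := integral_mul_fderiv_eq_neg_fderiv_mul_of_integrable (μ := volume)
    (f := fun _ : EuclideanSpace ℝ (Fin n) => (1 : ℝ)) (g := F)
    (v := EuclideanSpace.single i (1 : ℝ)) (by simp)
    (by simpa using hd.integrable_of_hasCompactSupport (hc.fderiv_apply ℝ _))
    (by simpa using hF.continuous.integrable_of_hasCompactSupport hc)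
    (fun _ _ => differentiableAt_const _) (fun x _ => hF.differentiable one_ne_zero x)
  simpa [pderiv] using h

/-- A `C¹` cutoff function on the line which vanishes on `(-∞, 1]` and is one on `[2, ∞)`. -/
theorem exists_contDiff_cutoff : ∃ (χ : ℝ → ℝ) (B : ℝ), ContDiff ℝ 1 χ ∧ (∀ t ≤ 1, χ t = 0) ∧
    (∀ t, 2 ≤ t → χ t = 1) ∧ (∀ t, |χ t| ≤ 1) ∧ (∀ t < 1, deriv χ t = 0) ∧
    (∀ t, 2 < t → deriv χ t = 0) ∧ ∀ t, |t * deriv χ t| ≤ B := by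
  set χ : ℝ → ℝ := fun t => Real.smoothTransition (t - 1) with hχ
  have h1 : ContDiff ℝ 1 χ := Real.smoothTransition.contDiff.comp (contDiff_id.sub contDiff_const)
  have h2 : ∀ t ≤ 1, χ t = 0 := fun t ht =>
    Real.smoothTransition.zero_of_nonpos (by linarith)
  have h3 : ∀ t, 2 ≤ t → χ t = 1 := fun t ht =>
    Real.smoothTransition.one_of_one_le (by linarith)
  have h4 : ∀ t < 1, deriv χ t = 0 := fun t ht => by
    have : χ =ᶠ[𝓝 t] fun _ => 0 := by
      filter_upwards [gt_mem_nhds ht] with s hs using h2 s hs.le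
    simpa using this.deriv_eq
  have h5 : ∀ t, 2 < t → deriv χ t = 0 := fun t ht => by
    have : χ =ᶠ[𝓝 t] fun _ => 1 := by
      filter_upwards [lt_mem_nhds ht] with s hs using h3 s hs.le
    simpa using this.deriv_eq
  have hcont : Continuous fun t => t * deriv χ t :=
    continuous_id.mul (h1.continuous_deriv le_rfl)
  obtain ⟨B, hB⟩ := (isCompact_Icc (a := (1 : ℝ)) (b := 2)).exists_bound_of_continuousOn
    hcont.continuousOn
  refine ⟨χ, max B 0, h1, h2, h3, fun t => ?_, h4, h5, fun t => ?_⟩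
  · rw [abs_of_nonneg (Real.smoothTransition.nonneg _)]
    exact Real.smoothTransition.le_one _
  · rcases lt_or_ge t 1 with ht | ht
    · simp [h4 t ht]
    · rcases lt_or_ge 2 t with ht2 | ht2
      · simp [h5 t ht2]
      · exact le_max_of_le_left (hB t ⟨ht, ht2⟩)

/-- A `C¹` vector field `W` on a bounded open set has vanishing total divergence, if it is
controlled by a function `w` which tends to zero at the boundary. -/
theorem setIntegral_divergence_eq_zero {Ω : Set (EuclideanSpace ℝ (Fin n))} (hΩo : IsOpen Ω)
    (hΩb : Bornology.IsBounded Ω) {w : EuclideanSpace ℝ (Fin n) → ℝ}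
    {W : Fin n → EuclideanSpace ℝ (Fin n) → ℝ} {C : ℝ}
    (hw : ContDiffOn ℝ 1 w Ω) (hw0 : ∀ x ∈ Ω, 0 ≤ w x)
    (hwc : ∀ ε > 0, IsCompact {x | x ∈ Ω ∧ ε ≤ w x})
    (hW : ∀ i, ContDiffOn ℝ 1 (W i) Ω)
    (hwW : ∀ x ∈ Ω, |∑ i, pderiv i w x * W i x| ≤ C * w x)
    (hdiv : ∀ x ∈ Ω, |∑ i, pderiv i (W i) x| ≤ C)
    (hdiv0 : ∀ x ∈ Ω, w x = 0 → ∑ i, pderiv i (W i) x = 0) :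
    ∫ x in Ω, ∑ i, pderiv i (W i) x = 0 := by
  classical
  obtain ⟨χ, B, hχ, hχ0, hχ1, hχle, hχ0', hχ1', hχB⟩ := exists_contDiff_cutoff
  -- The cut-off fields χ((m + 1) w) W live on the compact set `Q m` inside Ω, so their extensions
  -- by zero are C¹ with compact support on all of ℝⁿ.
  set F : ℕ → Fin n → EuclideanSpace ℝ (Fin n) → ℝ := fun m i =>
    Ω.indicator fun x => χ ((m + 1) * w x) * W i x with hFdef
  have hm : ∀ m : ℕ, (0 : ℝ) < 1 / (m + 1) := fun m => by positivity
  set Q : ℕ → Set (EuclideanSpace ℝ (Fin n)) := fun m => {x | x ∈ Ω ∧ 1 / (m + 1 : ℝ) ≤ w x}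
    with hQ
  have hF0 : ∀ m i x, x ∉ Q m → F m i x = 0 := by
    intro m i x hx
    by_cases hxΩ : x ∈ Ω
    · have : w x < 1 / (m + 1 : ℝ) := by
        by_contra h
        exact hx ⟨hxΩ, not_lt.1 h⟩
      rw [lt_div_iff₀ (by positivity)] at this
      simp only [hFdef, indicator_of_mem hxΩ]
      rw [hχ0 _ (by linarith), zero_mul]
    · simp [hFdef, hxΩ]
  have hF0' : ∀ m i x, x ∉ Q m → F m i =ᶠ[𝓝 x] fun _ => 0 := by
    intro m i x hx
    filter_upwards [(hwc _ (hm m)).isClosed.isOpen_compl.mem_nhds hx] with y hy using hF0 m i y hy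
  have hFΩ : ∀ m i x, x ∈ Ω → F m i =ᶠ[𝓝 x] fun y => χ ((m + 1) * w y) * W i y := by
    intro m i x hx
    filter_upwards [hΩo.mem_nhds hx] with y hy
    simp [hFdef, hy]
  have hFC : ∀ m i, ContDiff ℝ 1 (F m i) := by
    intro m i
    refine contDiff_iff_contDiffAt.2 fun x => ?_
    by_cases hx : x ∈ Q m
    · have hx' := hΩo.mem_nhds hx.1
      refine ContDiffAt.congr_of_eventuallyEq ?_ (hFΩ m i x hx.1)
      exact (hχ.contDiffAt.comp x (contDiffAt_const.mul (hw.contDiffAt hx'))).mul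
        ((hW i).contDiffAt hx')
    · exact contDiffAt_const.congr_of_eventuallyEq (hF0' m i x hx)
  have hFs : ∀ m i, HasCompactSupport (F m i) := fun m i =>
    HasCompactSupport.intro (hwc _ (hm m)) fun x hx => hF0 m i x hx
  have hd0 : ∀ m i x, x ∉ Ω → pderiv i (F m i) x = 0 := by
    intro m i x hx
    rw [pderiv, (hF0' m i x fun h => hx h.1).fderiv_eq]
    simp
  have hdΩ : ∀ m i x, x ∈ Ω → pderiv i (F m i) x =
      deriv χ ((m + 1) * w x) * ((m + 1) * pderiv i w x) * W i x
        + χ ((m + 1) * w x) * pderiv i (W i) x := by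
    intro m i x hx
    have hx' := hΩo.mem_nhds hx
    have hwd := ((hw.contDiffAt hx').differentiableAt one_ne_zero)
    have hWd := (((hW i).contDiffAt hx').differentiableAt one_ne_zero)
    have hχd := (hχ.differentiable one_ne_zero ((m + 1) * w x)).hasDerivAt
    have e := ((hχd.comp_hasFDerivAt x (hwd.hasFDerivAt.const_mul (m + 1 : ℝ))).mul
      hWd.hasFDerivAt)
    have e' : HasFDerivAt (F m i) _ x := e.congr_of_eventuallyEq (hFΩ m i x hx)
    rw [pderiv, e'.fderiv]
    simp [pderiv]
    ring
  have hint : ∀ m, ∫ x in Ω, ∑ i, pderiv i (F m i) x = 0 := by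
    intro m
    rw [setIntegral_eq_integral_of_forall_compl_eq_zero
      fun x hx => Finset.sum_eq_zero fun i _ => hd0 m i x hx, integral_finsetSum]
    · exact Finset.sum_eq_zero fun i _ => integral_pderiv_eq_zero (hFC m i) (hFs m i) i
    · intro i _
      exact (((hFC m i).continuous_fderiv one_ne_zero).clm_apply
        continuous_const).integrable_of_hasCompactSupport ((hFs m i).fderiv_apply ℝ _)
  have hsum : ∀ m x, x ∈ Ω → ∑ i, pderiv i (F m i) x =
      ((m + 1) * deriv χ ((m + 1) * w x)) * (∑ i, pderiv i w x * W i x)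
        + χ ((m + 1) * w x) * ∑ i, pderiv i (W i) x := by
    intro m x hx
    rw [Finset.mul_sum, Finset.mul_sum, ← Finset.sum_add_distrib]
    refine Finset.sum_congr rfl fun i _ => ?_
    rw [hdΩ m i x hx]; ring
  have hlim : Tendsto (fun m => ∫ x in Ω, ∑ i, pderiv i (F m i) x) atTop
      (𝓝 (∫ x in Ω, ∑ i, pderiv i (W i) x)) := by
    -- The cutoff contributes (m + 1) χ'((m + 1) w) ∇w · W. Since |∇w · W| ≤ C w, it is at most C |t
    -- χ'(t)| ≤ B C with t = (m + 1) w, uniformly in m.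
    refine tendsto_integral_of_dominated_convergence (fun _ => B * C + C) ?_ ?_ ?_ ?_
    · intro m
      refine Continuous.aestronglyMeasurable (continuous_finsetSum _ fun i _ => ?_)
      exact ((hFC m i).continuous_fderiv one_ne_zero).clm_apply continuous_const
    · exact integrableOn_const hΩb.measure_lt_top.ne
    · intro m
      refine (ae_restrict_iff' hΩo.measurableSet).2 (Eventually.of_forall fun x hx => ?_)
      rw [hsum m x hx, Real.norm_eq_abs]
      have hC : 0 ≤ C := (abs_nonneg _).trans (hdiv x hx)
      refine (abs_add_le _ _).trans (add_le_add ?_ ?_)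
      · rw [abs_mul]
        calc |(m + 1) * deriv χ ((m + 1) * w x)| * |∑ i, pderiv i w x * W i x|
            ≤ |(m + 1) * deriv χ ((m + 1) * w x)| * (C * w x) :=
              mul_le_mul_of_nonneg_left (hwW x hx) (abs_nonneg _)
          _ = |(m + 1) * w x * deriv χ ((m + 1) * w x)| * C := by
              rw [abs_mul, abs_mul, abs_mul, abs_of_nonneg (hw0 x hx)]; ring
          _ ≤ B * C := mul_le_mul_of_nonneg_right (hχB _) hC
      · rw [abs_mul]
        calc _ ≤ 1 * C := mul_le_mul (hχle _) (hdiv x hx) (abs_nonneg _) zero_le_one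
          _ = C := one_mul C
    · refine (ae_restrict_iff' hΩo.measurableSet).2 (Eventually.of_forall fun x hx => ?_)
      refine tendsto_const_nhds.congr' ?_
      -- Where w vanishes inside Ω the cut-off divergences are all 0, so the limit there is right
      -- only because div W is also 0. Elsewhere (m + 1) w eventually exceeds 2 and the cutoff is
      -- locally 1.
      rcases (hw0 x hx).eq_or_lt with h0 | h0
      · refine Eventually.of_forall fun m => ?_
        beta_reduce
        rw [hsum m x hx, ← h0, mul_zero, hχ0 0 zero_le_one, hχ0' 0 zero_lt_one, hdiv0 x hx h0.symm]
        simp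
      · obtain ⟨N, hN⟩ := exists_nat_gt (2 / w x)
        filter_upwards [eventually_ge_atTop N] with m hmN
        have h2 : 2 < (m + 1) * w x := by
          rw [div_lt_iff₀ h0] at hN
          have : (N : ℝ) ≤ m := by exact_mod_cast hmN
          nlinarith
        rw [hsum m x hx, hχ1 _ h2.le, hχ1' _ h2]
        simp
  simp only [hint] at hlim
  exact (tendsto_nhds_unique hlim tendsto_const_nhds)

end Divergence

/-! ### Boundary regularity and boundary derivatives -/

section Boundary

variable {n : ℕ} {Ω : Set (EuclideanSpace ℝ (Fin n))} {p v : EuclideanSpace ℝ (Fin n)}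
  {ψ : EuclideanSpace ℝ (Fin n) → ℝ}

theorem IsLocalDefiningFunction.eq_zero (hΩo : IsOpen Ω) (hp : p ∈ frontier Ω)
    (hψ : IsLocalDefiningFunction Ω p ψ) : ψ p = 0 := by
  obtain ⟨h1, -, h3⟩ := hψ
  refine le_antisymm ?_ ?_
  · by_contra h
    have h4 : ∀ᶠ x in 𝓝 p, 0 < ψ x := h1.continuousAt.eventually (lt_mem_nhds (not_le.1 h))
    obtain ⟨x, hx1, hx2, hx3⟩ := ((mem_closure_iff_frequently.1
      (frontier_subset_closure hp)).and_eventually (h3.and h4)).exists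
    exact absurd (hx2.1 hx1) hx3.not_gt
  · by_contra h
    have : p ∈ Ω := h3.self_of_nhds.2 (not_le.1 h)
    rw [hΩo.frontier_eq] at hp
    exact hp.2 this

/-- Since ψ(p) = 0, the sign of ψ(p + tv) for small t > 0 is that of its slope dψ(v). -/
theorem IsLocalDefiningFunction.eventually_mem (hΩo : IsOpen Ω) (hp : p ∈ frontier Ω)
    (hψ : IsLocalDefiningFunction Ω p ψ) (v : EuclideanSpace ℝ (Fin n)) :
    (fderiv ℝ ψ p v < 0 → ∀ᶠ t in 𝓝[>] (0 : ℝ), p + t • v ∈ Ω) ∧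
    (0 < fderiv ℝ ψ p v → ∀ᶠ t in 𝓝[>] (0 : ℝ), p + t • v ∉ Ω) := by
  have h0 := hψ.eq_zero hΩo hp
  obtain ⟨h1, -, h3⟩ := hψ
  have hd : HasDerivAt (fun t : ℝ => ψ (p + t • v)) (fderiv ℝ ψ p v) 0 :=
    ((h1.differentiableAt two_ne_zero).hasFDerivAt.hasLineDerivAt v)
  have hs : Tendsto (slope (fun t : ℝ => ψ (p + t • v)) 0) (𝓝[>] 0) (𝓝 (fderiv ℝ ψ p v)) :=
    (hasDerivAt_iff_tendsto_slope.1 hd).mono_left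
      (nhdsWithin_mono _ fun t (ht : 0 < t) => ht.ne')
  have hcont : Tendsto (fun t : ℝ => p + t • v) (𝓝[>] 0) (𝓝 p) := by
    have : ContinuousAt (fun t : ℝ => p + t • v) 0 := by fun_prop
    simpa [ContinuousAt] using this.tendsto.mono_left nhdsWithin_le_nhds
  have hmem := hcont.eventually h3
  have hpos : ∀ᶠ t in 𝓝[>] (0 : ℝ), 0 < t := self_mem_nhdsWithin
  constructor
  · intro hv
    filter_upwards [hmem, hpos, hs.eventually (gt_mem_nhds hv)] with t h4 h5 h6
    rw [slope_def_field] at h6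
    simp only [zero_smul, add_zero, h0, sub_zero] at h6
    rw [div_lt_iff₀ h5, zero_mul] at h6
    exact h4.2 h6
  · intro hv
    filter_upwards [hmem, hpos, hs.eventually (lt_mem_nhds hv)] with t h4 h5 h6
    rw [slope_def_field] at h6
    simp only [zero_smul, add_zero, h0, sub_zero] at h6
    rw [lt_div_iff₀ h5, zero_mul] at h6
    exact fun h => absurd (h4.1 h) h6.not_gt

theorem exists_fderiv_eq_one (hψ : IsLocalDefiningFunction Ω p ψ) :
    ∃ v, fderiv ℝ ψ p v = 1 := by
  obtain ⟨v, hv⟩ : ∃ v, fderiv ℝ ψ p v ≠ 0 := by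
    by_contra! h
    exact hψ.2.1 (ContinuousLinearMap.ext h)
  exact ⟨(fderiv ℝ ψ p v)⁻¹ • v, by simp [hv]⟩

/-- At a boundary point the tangent cone contains the nonempty open half-space {dψ < 0}, which
spans. This makes derivatives within the closure unique, and so continuous up to the boundary. -/
theorem uniqueDiffOn_closure_of_hasC2Boundary (hΩo : IsOpen Ω) (hΩ2 : HasC2Boundary Ω) :
    UniqueDiffOn ℝ (closure Ω) := by
  intro p hp
  by_cases hpΩ : p ∈ Ω
  · exact (hΩo.uniqueDiffWithinAt hpΩ).mono subset_closure
  have hpf : p ∈ frontier Ω := by rw [hΩo.frontier_eq]; exact ⟨hp, hpΩ⟩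
  obtain ⟨ψ, hψ⟩ := hΩ2 p hpf
  refine UniqueDiffWithinAt.mono ⟨?_, hp⟩ subset_closure
  have hsub : {v | fderiv ℝ ψ p v < 0} ⊆ tangentConeAt ℝ Ω p := fun v hv =>
    mem_tangentConeAt_of_add_smul_mem (l := 𝓝[>] (0 : ℝ)) (c := id)
      (tendsto_id.mono_left (nhdsWithin_mono _ fun t (ht : 0 < t) => ht.ne'))
      ((hψ.eventually_mem hΩo hpf v).1 hv)
  have hopen : IsOpen {v | fderiv ℝ ψ p v < 0} :=
    isOpen_lt (fderiv ℝ ψ p).continuous continuous_const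
  have htop : Submodule.span ℝ (tangentConeAt ℝ Ω p) = ⊤ := by
    refine Submodule.eq_top_of_nonempty_interior' _ ?_
    obtain ⟨v, hv⟩ := exists_fderiv_eq_one hψ
    refine ⟨-v, mem_interior.2 ⟨_, hsub.trans Submodule.subset_span, hopen, ?_⟩⟩
    simp [hv]
  rw [htop]
  exact dense_univ

/-- Otherwise Ω and the exterior of its closure would disconnect the segment. -/
theorem exists_mem_segment_frontier {E : Type*} [NormedAddCommGroup E] [NormedSpace ℝ E]
    {Ω : Set E} (hΩo : IsOpen Ω) {a b : E} (ha : a ∈ Ω) (hb : b ∉ Ω) :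
    ∃ z ∈ segment ℝ a b, z ∈ frontier Ω := by
  by_contra! h
  have hcov : segment ℝ a b ⊆ Ω ∪ (closure Ω)ᶜ := fun z hz => by
    by_cases hz' : z ∈ closure Ω
    · left
      by_contra hz''
      exact h z hz (by rw [hΩo.frontier_eq]; exact ⟨hz', hz''⟩)
    · exact Or.inr hz'
  have hdisj : segment ℝ a b ∩ (Ω ∩ (closure Ω)ᶜ) = ∅ := by
    rw [eq_empty_iff_forall_notMem]
    rintro z ⟨-, hz1, hz2⟩
    exact hz2 (subset_closure hz1)
  rcases (isPreconnected_iff_subset_of_disjoint.1 (convex_segment a b).isPreconnected) Ω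
    (closure Ω)ᶜ hΩo isClosed_closure.isOpen_compl hcov hdisj with h2 | h2
  · exact hb (h2 (right_mem_segment ℝ a b))
  · exact h2 (left_mem_segment ℝ a b) (subset_closure ha)

/-- The tangential derivatives of a function which is constant on the boundary vanish. -/
theorem fderivWithin_eq_zero_of_tangent (hΩo : IsOpen Ω) (hp : p ∈ frontier Ω)
    (hψ : IsLocalDefiningFunction Ω p ψ) {u : EuclideanSpace ℝ (Fin n) → ℝ} {c : ℝ}
    (hu : DifferentiableWithinAt ℝ u (closure Ω) p) (hc : ∀ x ∈ frontier Ω, u x = c)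
    (hv : fderiv ℝ ψ p v = 0) : fderivWithin ℝ u (closure Ω) p v = 0 := by
  obtain ⟨m, hm⟩ := exists_fderiv_eq_one hψ
  set L := fderivWithin ℝ u (closure Ω) p with hL
  set M : ℝ := |L m| + (‖v‖ + ‖m‖) with hM
  have hM0 : 0 ≤ M := by positivity
  -- For m transversal to the boundary, p + t(v - εm) lies in Ω and p + t(v + εm) does not, so the
  -- segment between them meets ∂Ω at some p + t(v + sm) with |s| ≤ ε. There u = c again, and
  -- differentiability at p makes L(v + sm) of size O(ε).
  have key : ∀ ε : ℝ, 0 < ε → ε ≤ 1 → |L v| ≤ ε * M := by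
    intro ε hε hε1
    have h1 := ((hψ.eventually_mem hΩo hp (v - ε • m)).1 (by simp [hv, hm, hε]))
    have h2 := ((hψ.eventually_mem hΩo hp (v + ε • m)).2 (by simp [hv, hm, hε]))
    have h3 := hu.hasFDerivWithinAt.isLittleO.def hε
    rw [eventually_nhdsWithin_iff, Metric.eventually_nhds_iff] at h3
    obtain ⟨r, hr, h3⟩ := h3
    have h4 : ∀ᶠ t in 𝓝[>] (0 : ℝ), t * (‖v‖ + ‖m‖) < r := by
      have : ContinuousAt (fun t : ℝ => t * (‖v‖ + ‖m‖)) 0 := by fun_prop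
      exact (this.eventually (gt_mem_nhds (by simpa using hr))).filter_mono nhdsWithin_le_nhds
    have hpos : ∀ᶠ t in 𝓝[>] (0 : ℝ), 0 < t := self_mem_nhdsWithin
    obtain ⟨t, h1, h2, h4, ht⟩ := (h1.and (h2.and (h4.and hpos))).exists
    obtain ⟨z, hz, hzf⟩ := exists_mem_segment_frontier hΩo h1 h2
    obtain ⟨a, b, ha, hb, hab, rfl⟩ := hz
    obtain ⟨s, hs, hzs⟩ : ∃ s : ℝ, |s| ≤ ε ∧
        a • (p + t • (v - ε • m)) + b • (p + t • (v + ε • m)) = p + t • (v + s • m) := by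
      refine ⟨(b - a) * ε, ?_, ?_⟩
      · rw [abs_mul, abs_of_pos hε]
        exact mul_le_of_le_one_left hε.le (abs_le.2 ⟨by linarith, by linarith⟩)
      · obtain rfl : b = 1 - a := by linarith
        module
    rw [hzs] at hzf
    have hnorm : ‖v + s • m‖ ≤ ‖v‖ + ‖m‖ := by
      refine (norm_add_le _ _).trans (add_le_add le_rfl ?_)
      rw [norm_smul, Real.norm_eq_abs]
      exact mul_le_of_le_one_left (norm_nonneg _) (hs.trans hε1)
    have hnorm' : ‖t • (v + s • m)‖ ≤ t * (‖v‖ + ‖m‖) := by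
      rw [norm_smul, Real.norm_of_nonneg ht.le]
      exact mul_le_mul_of_nonneg_left hnorm ht.le
    have h5 := h3 (y := p + t • (v + s • m)) (by simpa using hnorm'.trans_lt h4)
      (frontier_subset_closure hzf)
    rw [hc _ hzf, hc _ hp, add_sub_cancel_left, sub_self, zero_sub, norm_neg, map_smul, norm_smul,
      norm_smul, Real.norm_of_nonneg ht.le, mul_left_comm, mul_le_mul_iff_right₀ ht, map_add,
      map_smul, Real.norm_eq_abs, smul_eq_mul] at h5
    have h6 : |L v| ≤ |L v + s * L m| + |s * L m| := by
      have := abs_sub (L v + s * L m) (s * L m)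
      rwa [add_sub_cancel_right] at this
    have h7 : |s * L m| ≤ ε * |L m| := by
      rw [abs_mul]
      exact mul_le_mul_of_nonneg_right hs (abs_nonneg _)
    have h8 := mul_le_mul_of_nonneg_left hnorm hε.le
    rw [hM, mul_add]
    linarith
  by_contra h
  have hpos : 0 < |L v| := abs_pos.2 h
  have hMp : 0 < M := by
    by_contra hM'
    have := key 1 one_pos le_rfl
    linarith
  -- This ε would force |L v| ≤ |L v| / 2.
  have h1 := key (min 1 (|L v| / (2 * M))) (by positivity) (min_le_left _ _)
  have h2 := mul_le_mul_of_nonneg_right (min_le_right 1 (|L v| / (2 * M))) hM0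
  have h3 : |L v| / (2 * M) * M = |L v| / 2 := by field_simp
  linarith

/-- A function with constant boundary values and normal derivative `c₂` has `|∇u|² = c₂²` on the
boundary. -/
theorem sum_sq_fderivWithin_of_normal_derivative {K c c₂ : ℝ} (hΩo : IsOpen Ω)
    (hp : p ∈ frontier Ω) (hΩ2 : HasC2Boundary Ω) (hq : 0 < confDen K p)
    {u : EuclideanSpace ℝ (Fin n) → ℝ} (hu : DifferentiableWithinAt ℝ u (closure Ω) p)
    (hc : ∀ x ∈ frontier Ω, u x = c)
    (hN : ∀ ν, IsOutwardUnitNormal (spaceFormMetric K) Ω p ν →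
      fderivWithin ℝ u (closure Ω) p ν = c₂) :
    confDen K p ^ 2 * ∑ i, fderivWithin ℝ u (closure Ω) p (EuclideanSpace.single i 1) ^ 2 =
      c₂ ^ 2 := by
  obtain ⟨ψ, hψ⟩ := hΩ2 p hp
  obtain ⟨m, hm⟩ := exists_fderiv_eq_one hψ
  set L := fderivWithin ℝ u (closure Ω) p with hL
  set d := fderiv ℝ ψ p with hd
  set q := confDen K p with hqdef
  -- L vanishes on the kernel of dψ and is therefore a multiple of it.
  have hLd : ∀ v, L v = L m * d v := by
    intro v
    have := fderivWithin_eq_zero_of_tangent (v := v - d v • m) hΩo hp hψ hu hc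
      (by simp [← hd, hm])
    rw [← hL, map_sub, map_smul, smul_eq_mul] at this
    linarith
  have hdv : ∀ v, d v = ∑ i, d (EuclideanSpace.single i 1) * v i := by
    intro v
    conv_lhs => rw [← (EuclideanSpace.basisFun (Fin n) ℝ).sum_repr v]
    simp [mul_comm]
  set S := ∑ i, d (EuclideanSpace.single i 1) ^ 2 with hS
  have hSpos : 0 < S := by
    refine lt_of_le_of_ne (Finset.sum_nonneg fun i _ => sq_nonneg _) fun h => ?_
    have h0 := (Finset.sum_eq_zero_iff_of_nonneg fun i _ => sq_nonneg _).1 h.symm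
    have : d m = 0 := by
      rw [hdv]
      exact Finset.sum_eq_zero fun i hi => by rw [pow_eq_zero_iff two_ne_zero |>.1 (h0 i hi), zero_mul]
    rw [hm] at this
    exact one_ne_zero this
  -- The g-length of dψ; ν below is the g-gradient q² ∂ᵢψ of ψ divided by it.
  set a := q * Real.sqrt S with ha
  have hapos : 0 < a := mul_pos hq (Real.sqrt_pos.2 hSpos)
  have ha2 : a ^ 2 = q ^ 2 * S := by rw [ha, mul_pow, Real.sq_sqrt hSpos.le]
  set ν : EuclideanSpace ℝ (Fin n) :=
    WithLp.toLp 2 fun i => q ^ 2 * d (EuclideanSpace.single i 1) / a with hν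
  have hνd : ∀ w, d w = a * metricInner (spaceFormMetric K) p ν w := by
    intro w
    rw [metricInner_spaceForm, hdv, Finset.mul_sum, Finset.mul_sum]
    refine Finset.sum_congr rfl fun i _ => ?_
    simp only [hν, ← hqdef]
    field_simp
  have hνν : d ν = a := by
    rw [hdv]
    have : ∀ i, d (EuclideanSpace.single i 1) * ν i =
        q ^ 2 / a * d (EuclideanSpace.single i 1) ^ 2 := fun i => by simp only [hν]; ring
    simp only [this, ← Finset.mul_sum, ← hS]
    rw [div_mul_eq_mul_div, ← ha2, sq, mul_div_assoc, div_self hapos.ne', mul_one]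
  have hcL := hN ν ⟨by
    have := hνd ν
    rw [hνν] at this
    exact (mul_left_cancel₀ hapos.ne' (by linarith)), ψ, hψ, a, hapos, hνd⟩
  rw [hLd, hνν] at hcL
  have hsq : ∀ i : Fin n, L (EuclideanSpace.single i 1) ^ 2 =
      L m ^ 2 * d (EuclideanSpace.single i 1) ^ 2 := fun i => by rw [hLd (EuclideanSpace.single i 1), mul_pow]
  simp only [hsq, ← Finset.mul_sum, ← hS]
  rw [← hcL, mul_pow, ha2]
  ring

end Boundary

/-! ### Calculus of line derivatives of real functions -/

section LineDerivatives

variable {E : Type*} [NormedAddCommGroup E] [NormedSpace ℝ E] {f g : E → ℝ} {a b : ℝ} {x v : E}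

theorem HasLineDerivAt.fun_mul (hf : HasLineDerivAt ℝ f a x v) (hg : HasLineDerivAt ℝ g b x v) :
    HasLineDerivAt ℝ (fun y => f y * g y) (a * g x + f x * b) x v := by
  simpa [HasLineDerivAt] using HasDerivAt.fun_mul (𝕜 := ℝ) hf hg

theorem HasLineDerivAt.fun_add (hf : HasLineDerivAt ℝ f a x v) (hg : HasLineDerivAt ℝ g b x v) :
    HasLineDerivAt ℝ (fun y => f y + g y) (a + b) x v :=
  HasDerivAt.fun_add (𝕜 := ℝ) hf hg

theorem HasLineDerivAt.fun_sub (hf : HasLineDerivAt ℝ f a x v) (hg : HasLineDerivAt ℝ g b x v) :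
    HasLineDerivAt ℝ (fun y => f y - g y) (a - b) x v :=
  HasDerivAt.fun_sub (𝕜 := ℝ) hf hg

theorem HasLineDerivAt.fun_const (c : ℝ) : HasLineDerivAt ℝ (fun _ : E => c) 0 x v :=
  hasDerivAt_const (𝕜 := ℝ) (0 : ℝ) c

theorem HasLineDerivAt.fun_const_mul (c : ℝ) (hf : HasLineDerivAt ℝ f a x v) :
    HasLineDerivAt ℝ (fun y => c * f y) (c * a) x v :=
  HasDerivAt.const_mul (𝕜 := ℝ) c hf

theorem HasLineDerivAt.fun_pow (m : ℕ) (hf : HasLineDerivAt ℝ f a x v) :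
    HasLineDerivAt ℝ (fun y => f y ^ m) (m * f x ^ (m - 1) * a) x v := by
  simpa [HasLineDerivAt] using HasDerivAt.fun_pow (𝕜 := ℝ) hf m

theorem HasLineDerivAt.fun_inv (hf : HasLineDerivAt ℝ f a x v) (hx : f x ≠ 0) :
    HasLineDerivAt ℝ (fun y => (f y)⁻¹) (-a / f x ^ 2) x v := by
  simpa [HasLineDerivAt] using HasDerivAt.fun_inv (𝕜 := ℝ) hf (by simpa using hx)

theorem HasLineDerivAt.fun_sum {ι : Type*} {s : Finset ι} {f : ι → E → ℝ} {a : ι → ℝ}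
    (hf : ∀ i ∈ s, HasLineDerivAt ℝ (f i) (a i) x v) :
    HasLineDerivAt ℝ (fun y => ∑ i ∈ s, f i y) (∑ i ∈ s, a i) x v :=
  HasDerivAt.fun_sum (𝕜 := ℝ) hf

theorem HasLineDerivAt.congr_val (hf : HasLineDerivAt ℝ f a x v) (h : a = b) :
    HasLineDerivAt ℝ f b x v := h ▸ hf

end LineDerivatives

/-! ### The Codazzi equation and the divergence of the Newton tensors -/

section NewtonDivergence

open Matrix

variable {n : ℕ} {x : EuclideanSpace ℝ (Fin n)} {A : EuclideanSpace ℝ (Fin n) → Matrix (Fin n) (Fin n) ℝ}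

theorem hasLineDerivAt_elemSymm {i : Fin n} {A' : Matrix (Fin n) (Fin n) ℝ}
    (hA : ∀ a b, HasLineDerivAt ℝ (fun y => A y a b) (A' a b) x (EuclideanSpace.single i 1))
    (hs : ∀ m, DifferentiableAt ℝ (fun y => elemSymm m (A y)) x) (m : ℕ) :
    HasLineDerivAt ℝ (fun y => elemSymm (m + 1) (A y)) ((newtonTensor m (A x) * A').trace) x
      (EuclideanSpace.single i 1) := by
  have h := hasDerivAt_elemSymm (A := fun t : ℝ => A (x + t • EuclideanSpace.single i 1))
    (s := 0) (A' := A') hA (fun m => ((hs m).hasLineDerivAt_pderiv i).differentiableAt) m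
  simpa [HasLineDerivAt] using h

/-- The coordinate divergence of the Newton tensors of a symmetric matrix field whose derivative
satisfies the Codazzi equation of a conformally flat metric. -/
theorem sum_pderiv_newtonTensor
    (hs : ∀ m, DifferentiableAt ℝ (fun y => elemSymm m (A y)) x)
    (hT : ∀ m a b, DifferentiableAt ℝ (fun y => newtonTensor m (A y) a b) x)
    (hsymm : (A x)ᵀ = A x) {dA : Fin n → Matrix (Fin n) (Fin n) ℝ}
    (hdA : ∀ l a b, HasLineDerivAt ℝ (fun y => A y a b) (dA l a b) x (EuclideanSpace.single l 1))
    (hdsymm : ∀ l, (dA l)ᵀ = dA l) (X : Fin n → ℝ) (κ : ℝ)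
    (hcod : ∀ l i j, dA l i j - dA i l j = κ * (X l * A x i j - X i * A x l j
      - (A x *ᵥ X) l * (1 : Matrix (Fin n) (Fin n) ℝ) i j
      + (A x *ᵥ X) i * (1 : Matrix (Fin n) (Fin n) ℝ) l j)) (m : ℕ) (j : Fin n) :
    ∑ i, pderiv i (fun y => newtonTensor m (A y) i j) x =
      κ * (n * (newtonTensor m (A x) *ᵥ X) j - (n - m) * elemSymm m (A x) * X j) := by
  -- The right-hand side consists exactly of the Christoffel terms of the conformally flat metric,
  -- so the claim is ∇ᵢ(Tₘ)ⁱⱼ = 0 in coordinates. The induction differentiates Tₘ₊₁ = σₘ₊₁ - Tₘ A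
  -- with dσₘ₊₁ = tr(Tₘ dA).
  induction m generalizing j with
  | zero =>
    simp [newtonTensor, pderiv]
  | succ m ih =>
    set T := newtonTensor m (A x) with hTdef
    have hTs : Tᵀ = T := newtonTensor_transpose hsymm m
    have hder : ∀ i, pderiv i (fun y => newtonTensor (m + 1) (A y) i j) x =
        (T * dA i).trace * (1 : Matrix (Fin n) (Fin n) ℝ) i j -
          ∑ l, (pderiv i (fun y => newtonTensor m (A y) i l) x * A x l j + T i l * dA i l j) := by
      intro i
      refine HasLineDerivAt.pderiv_eq ?_ (hT _ _ _)
      have h1 := ((hasLineDerivAt_elemSymm (hdA i) hs m).fun_mul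
        (HasLineDerivAt.fun_const ((1 : Matrix (Fin n) (Fin n) ℝ) i j))).fun_sub
        (HasLineDerivAt.fun_sum (s := Finset.univ) fun l _ =>
          ((hT m i l).hasLineDerivAt_pderiv i).fun_mul (hdA i l j))
      simp only [newtonTensor, ← newtonTensor_commute]
      simpa [Matrix.mul_apply] using h1
    have htr : ∑ i, (T * dA i).trace * (1 : Matrix (Fin n) (Fin n) ℝ) i j
        = ∑ i, ∑ l, T i l * dA j i l := by
      rw [Finset.sum_eq_single j (fun i _ hi => by simp [hi]) (by simp)]
      simp only [Matrix.one_apply_eq, mul_one, Matrix.trace, Matrix.diag_apply, Matrix.mul_apply]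
      refine Finset.sum_congr rfl fun i _ => Finset.sum_congr rfl fun l _ => ?_
      rw [← congrFun (congrFun (hdsymm j) l) i]; rfl
    have hA' : ∀ a b, A x a b = A x b a := fun a b => congrFun (congrFun hsymm b) a
    have hT' : ∀ a b, T a b = T b a := fun a b => congrFun (congrFun hTs b) a
    have hd' : ∀ l a b, dA l a b = dA l b a := fun l a b => congrFun (congrFun (hdsymm l) b) a
    have hAT : A x *ᵥ (T *ᵥ X) = T *ᵥ (A x *ᵥ X) := by
      rw [Matrix.mulVec_mulVec, Matrix.mulVec_mulVec, newtonTensor_commute]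
    -- The only place where Codazzi enters: symmetry of T and dA leaves just this antisymmetrised
    -- derivative. Of its four terms two cancel, since A T X = T A X.
    have hC : ∑ i, ∑ l, T i l * (dA j i l - dA i j l) =
        κ * (X j * (T * A x).trace - (A x *ᵥ X) j * T.trace) := by
      have e1 : ∑ i, ∑ l, T i l * (X j * A x i l) = X j * (T * A x).trace := by
        simp only [Matrix.trace, Matrix.diag_apply, Matrix.mul_apply, Finset.mul_sum]
        refine Finset.sum_congr rfl fun i _ => Finset.sum_congr rfl fun l _ => ?_
        rw [hA' i l]; ring
      have e2 : ∑ i, ∑ l, T i l * (X i * A x j l) = (A x *ᵥ (T *ᵥ X)) j := by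
        simp only [Matrix.mulVec, dotProduct, Finset.mul_sum]
        rw [Finset.sum_comm]
        refine Finset.sum_congr rfl fun i _ => Finset.sum_congr rfl fun l _ => ?_
        rw [hT' i l]; ring
      have e3 : ∑ i, ∑ l, T i l * ((A x *ᵥ X) j * (1 : Matrix (Fin n) (Fin n) ℝ) i l) =
          (A x *ᵥ X) j * T.trace := by
        simp [Matrix.trace, Matrix.one_apply, Finset.mul_sum, mul_comm]
      have e4 : ∑ i, ∑ l, T i l * ((A x *ᵥ X) i * (1 : Matrix (Fin n) (Fin n) ℝ) j l) =
          (T *ᵥ (A x *ᵥ X)) j := by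
        simp only [Matrix.one_apply, mul_ite, mul_one, mul_zero, Finset.sum_ite_eq,
          Finset.mem_univ, if_true]
        rw [Matrix.mulVec, dotProduct]
        exact Finset.sum_congr rfl fun i _ => by rw [hT']
      calc ∑ i, ∑ l, T i l * (dA j i l - dA i j l)
          = κ * (∑ i, ∑ l, T i l * (X j * A x i l) - ∑ i, ∑ l, T i l * (X i * A x j l)
            - ∑ i, ∑ l, T i l * ((A x *ᵥ X) j * (1 : Matrix (Fin n) (Fin n) ℝ) i l)
            + ∑ i, ∑ l, T i l * ((A x *ᵥ X) i * (1 : Matrix (Fin n) (Fin n) ℝ) j l)) := by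
            simp only [← Finset.sum_sub_distrib, ← Finset.sum_add_distrib, Finset.mul_sum]
            refine Finset.sum_congr rfl fun i _ => Finset.sum_congr rfl fun l _ => ?_
            rw [hcod]; ring
        _ = _ := by rw [e1, e2, e3, e4, hAT]; ring
    have hD : ∑ i, ∑ l, pderiv i (fun y => newtonTensor m (A y) i l) x * A x l j =
        κ * (n * (A x *ᵥ (T *ᵥ X)) j - (n - m) * elemSymm m (A x) * (A x *ᵥ X) j) := by
      rw [Finset.sum_comm]
      simp only [← Finset.sum_mul, ih]
      have hmv : ∀ v : Fin n → ℝ, (A x *ᵥ v) j = ∑ l, A x j l * v l := fun _ => rfl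
      rw [hmv, hmv, Finset.mul_sum, Finset.mul_sum, ← Finset.sum_sub_distrib, Finset.mul_sum]
      refine Finset.sum_congr rfl fun l _ => ?_
      rw [hA' l j]
      ring
    have htot : ∑ i, pderiv i (fun y => newtonTensor (m + 1) (A y) i j) x =
        ∑ i, ∑ l, T i l * (dA j i l - dA i j l) -
          ∑ i, ∑ l, pderiv i (fun y => newtonTensor m (A y) i l) x * A x l j := by
      simp only [hder]
      rw [Finset.sum_sub_distrib, htr, ← Finset.sum_sub_distrib, ← Finset.sum_sub_distrib]
      refine Finset.sum_congr rfl fun i _ => ?_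
      rw [← Finset.sum_sub_distrib, ← Finset.sum_sub_distrib]
      refine Finset.sum_congr rfl fun l _ => ?_
      rw [hd' i j l]; ring
    have hTX : (newtonTensor (m + 1) (A x) *ᵥ X) j =
        elemSymm (m + 1) (A x) * X j - (A x *ᵥ (T *ᵥ X)) j := by
      rw [newtonTensor, Matrix.sub_mulVec, Matrix.smul_mulVec, Matrix.one_mulVec,
        Matrix.mulVec_mulVec]
      rfl
    rw [htot, hC, hD, hTX, ← succ_mul_elemSymm, trace_newtonTensor, Fintype.card_fin]
    push_cast
    ring

end NewtonDivergence

/-! ### The Hessian of the space form in conformal coordinates -/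

section ShiftedHessian

open Matrix

variable {n : ℕ} {K : ℝ} {x : EuclideanSpace ℝ (Fin n)} {u : EuclideanSpace ℝ (Fin n) → ℝ}

/-- The endomorphism `g⁻¹(∇²u + K u g)` at `x` in terms of the value `z`, the coordinate gradient
`p` and the coordinate Hessian `H` of `u` at `x`. -/
noncomputable def shiftedHessian (K : ℝ) (x : EuclideanSpace ℝ (Fin n)) (z : ℝ) (p : Fin n → ℝ)
    (H : Matrix (Fin n) (Fin n) ℝ) : Matrix (Fin n) (Fin n) ℝ :=
  Matrix.of fun i j => confDen K x ^ 2 * H i j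
    + K / 2 * confDen K x * (x i * p j + x j * p i
      - (∑ l, x l * p l) * (1 : Matrix (Fin n) (Fin n) ℝ) i j)
    + K * z * (1 : Matrix (Fin n) (Fin n) ℝ) i j

/-- The endomorphism field `g⁻¹(∇²u + K u g)`. -/
noncomputable def hessianField (K : ℝ) (u : EuclideanSpace ℝ (Fin n) → ℝ)
    (x : EuclideanSpace ℝ (Fin n)) : Matrix (Fin n) (Fin n) ℝ :=
  shiftedHessian K x (u x) (fun i => pderiv i u x) (Matrix.of fun i j => pderiv i (pderiv j u) x)

theorem pderiv_spaceFormMetric (hq : confDen K x ≠ 0) (i j m : Fin n) :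
    pderiv i (fun y => spaceFormMetric K y j m) x =
      -(K * x i) * (confDen K x ^ 3)⁻¹ * (1 : Matrix (Fin n) (Fin n) ℝ) j m := by
  have hfun : (fun y : EuclideanSpace ℝ (Fin n) => spaceFormMetric K y j m) = fun y =>
      (confDen K y ^ 2)⁻¹ * (1 : Matrix (Fin n) (Fin n) ℝ) j m := by
    funext y; simp [spaceFormMetric_eq]
  rw [hfun]
  refine HasLineDerivAt.pderiv_eq ?_ ?_
  · refine ((((hasLineDerivAt_confDen i).fun_pow 2).fun_inv (pow_ne_zero 2 hq)).fun_mul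
      (HasLineDerivAt.fun_const _)).congr_val ?_
    field_simp
    ring
  · exact ((differentiableAt_confDen.pow 2).inv (pow_ne_zero 2 hq)).mul_const _

/-- The Christoffel symbols of q⁻² δ are three Kronecker terms, and g⁻¹ = q² · 1. Since g is a
multiple of the identity, g⁻¹b is a symmetric matrix, so symmetric-matrix algebra applies directly.
-/
theorem inv_spaceFormMetric_mul_riemHessian (hq : confDen K x ≠ 0) :
    (spaceFormMetric K x)⁻¹ * (riemHessian (spaceFormMetric K) u x
      + (K * u x) • spaceFormMetric K x) = hessianField K u x := by
  have hΓ : ∀ l i j, christoffel (spaceFormMetric K) l i j x = -(K / 2) * (confDen K x)⁻¹ *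
      (x i * (1 : Matrix (Fin n) (Fin n) ℝ) j l + x j * (1 : Matrix (Fin n) (Fin n) ℝ) i l
        - x l * (1 : Matrix (Fin n) (Fin n) ℝ) i j) := by
    intro l i j
    rw [christoffel, spaceFormMetric_inv hq]
    simp only [pderiv_spaceFormMetric hq, Matrix.smul_apply, smul_eq_mul]
    rw [Finset.sum_eq_single l (fun m _ hm => by simp [Matrix.one_apply_ne' hm]) (by simp)]
    rw [Matrix.one_apply_eq]
    field_simp
    ring
  ext i j
  rw [spaceFormMetric_inv hq, Matrix.smul_mul, Matrix.one_mul]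
  simp only [Matrix.smul_apply, Matrix.add_apply, smul_eq_mul, riemHessian, Matrix.of_apply, hΓ,
    hessianField, shiftedHessian, spaceFormMetric_eq]
  have hsum : ∑ l, -(K / 2) * (confDen K x)⁻¹ *
      (x i * (1 : Matrix (Fin n) (Fin n) ℝ) j l + x j * (1 : Matrix (Fin n) (Fin n) ℝ) i l
        - x l * (1 : Matrix (Fin n) (Fin n) ℝ) i j) * pderiv l u x =
      -(K / 2) * (confDen K x)⁻¹ * (x i * pderiv j u x + x j * pderiv i u x
        - (∑ l, x l * pderiv l u x) * (1 : Matrix (Fin n) (Fin n) ℝ) i j) := by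
    have e : ∀ (c : ℝ) (a : Fin n), ∑ l, c * (1 : Matrix (Fin n) (Fin n) ℝ) a l * pderiv l u x
        = c * pderiv a u x := fun c a => by simp [Matrix.one_apply]
    rw [← e (x i) j, ← e (x j) i, Finset.sum_mul, ← Finset.sum_add_distrib,
      ← Finset.sum_sub_distrib, Finset.mul_sum]
    refine Finset.sum_congr rfl fun l _ => ?_
    ring
  rw [hsum]
  field_simp
  ring

theorem sum_coord_mul_self : ∑ i, x i * x i = ‖x‖ ^ 2 := by
  rw [EuclideanSpace.norm_sq_eq]
  exact Finset.sum_congr rfl fun i _ => by rw [Real.norm_eq_abs, sq_abs, sq]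

theorem shiftedHessian_mulVec (z : ℝ) (p : Fin n → ℝ) (H : Matrix (Fin n) (Fin n) ℝ)
    (v : Fin n → ℝ) (i : Fin n) : (shiftedHessian K x z p H *ᵥ v) i =
      confDen K x ^ 2 * (∑ j, H i j * v j) + K / 2 * confDen K x * (x i * (∑ j, p j * v j)
        + p i * (∑ j, x j * v j) - (∑ l, x l * p l) * v i) + K * z * v i := by
  have e : ∀ c : ℝ, ∑ j, c * (1 : Matrix (Fin n) (Fin n) ℝ) i j * v j = c * v i :=
    fun c => by simp [Matrix.one_apply]
  rw [← e (∑ l, x l * p l), ← e (K * z)]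
  simp only [Finset.mul_sum, ← Finset.sum_add_distrib, ← Finset.sum_sub_distrib]
  simp only [shiftedHessian, Matrix.mulVec, dotProduct, Matrix.of_apply]
  refine Finset.sum_congr rfl fun j _ => ?_
  ring

theorem shiftedHessian_transpose {z : ℝ} {p : Fin n → ℝ} {H : Matrix (Fin n) (Fin n) ℝ}
    (hH : Hᵀ = H) : (shiftedHessian K x z p H)ᵀ = shiftedHessian K x z p H := by
  ext i j
  have h1 : H j i = H i j := congrFun (congrFun hH i) j
  have h2 : (1 : Matrix (Fin n) (Fin n) ℝ) j i = (1 : Matrix (Fin n) (Fin n) ℝ) i j := by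
    simp [Matrix.one_apply, eq_comm]
  simp only [shiftedHessian, Matrix.transpose_apply, Matrix.of_apply, h1, h2]
  ring

theorem hessianField_transpose (hu : ContDiffAt ℝ 2 u x) :
    (hessianField K u x)ᵀ = hessianField K u x :=
  shiftedHessian_transpose (Matrix.ext fun i j => pderiv_comm hu j i)

/-- The derivative of `g⁻¹(∇²u + K u g)` in the direction of the `l`-th coordinate. -/
noncomputable def dHessianField (K : ℝ) (u : EuclideanSpace ℝ (Fin n) → ℝ)
    (x : EuclideanSpace ℝ (Fin n)) (l : Fin n) : Matrix (Fin n) (Fin n) ℝ :=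
  Matrix.of fun i j => K * x l * confDen K x * pderiv i (pderiv j u) x
    + confDen K x ^ 2 * pderiv l (pderiv i (pderiv j u)) x
    + K / 2 * (K * x l / 2) * (x i * pderiv j u x + x j * pderiv i u x
      - (∑ m, x m * pderiv m u x) * (1 : Matrix (Fin n) (Fin n) ℝ) i j)
    + K / 2 * confDen K x * ((1 : Matrix (Fin n) (Fin n) ℝ) l i * pderiv j u x
      + x i * pderiv l (pderiv j u) x + (1 : Matrix (Fin n) (Fin n) ℝ) l j * pderiv i u x
      + x j * pderiv l (pderiv i u) x
      - (pderiv l u x + ∑ m, x m * pderiv l (pderiv m u) x)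
        * (1 : Matrix (Fin n) (Fin n) ℝ) i j)
    + K * pderiv l u x * (1 : Matrix (Fin n) (Fin n) ℝ) i j

theorem hasLineDerivAt_hessianField (hu : ContDiffAt ℝ 3 u x) (l i j : Fin n) :
    HasLineDerivAt ℝ (fun y => hessianField K u y i j) (dHessianField K u x l i j) x
      (EuclideanSpace.single l 1) := by
  have h1 : ∀ a, ContDiffAt ℝ 2 (pderiv a u) x := fun a =>
    contDiffAt_pderiv (hu.of_le (by norm_num)) a
  have h2 : ∀ a b, ContDiffAt ℝ 1 (pderiv a (pderiv b u)) x := fun a b =>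
    contDiffAt_pderiv ((h1 b).of_le (by norm_num)) a
  have d0 := (hu.differentiableAt (by norm_num)).hasLineDerivAt_pderiv l
  have d1 := fun a => ((h1 a).differentiableAt (by norm_num)).hasLineDerivAt_pderiv l
  have d2 := ((h2 i j).differentiableAt (by norm_num)).hasLineDerivAt_pderiv l
  have dq : HasLineDerivAt ℝ (confDen K) (K * x l / 2) x (EuclideanSpace.single l 1) :=
    hasLineDerivAt_confDen l
  have dδ : HasLineDerivAt ℝ (fun _ => (1 : Matrix (Fin n) (Fin n) ℝ) i j) 0 x
    (EuclideanSpace.single l 1) := HasLineDerivAt.fun_const _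
  have ds := HasLineDerivAt.fun_sum (s := Finset.univ) fun m _ =>
    (hasLineDerivAt_coord (x := x) l m).fun_mul (d1 m)
  have := (((dq.fun_pow 2).fun_mul d2).fun_add ((dq.fun_const_mul (K / 2)).fun_mul
    ((((hasLineDerivAt_coord l i).fun_mul (d1 j)).fun_add
      ((hasLineDerivAt_coord l j).fun_mul (d1 i))).fun_sub (ds.fun_mul dδ)))).fun_add
    ((d0.fun_const_mul K).fun_mul dδ)
  refine HasLineDerivAt.congr_val this ?_
  simp only [dHessianField, Matrix.of_apply, Finset.sum_add_distrib]
  have e : ∑ m, (1 : Matrix (Fin n) (Fin n) ℝ) l m * pderiv m u x = pderiv l u x := by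
    simp [Matrix.one_apply]
  rw [e]
  push_cast
  ring

theorem dHessianField_transpose {Ω : Set (EuclideanSpace ℝ (Fin n))} (hΩ : IsOpen Ω)
    (hu : ContDiffOn ℝ 3 u Ω) (hx : x ∈ Ω) (l : Fin n) :
    (dHessianField K u x l)ᵀ = dHessianField K u x l := by
  have hu2 : ∀ y ∈ Ω, ContDiffAt ℝ 2 u y := fun y hy =>
    (hu.contDiffAt (hΩ.mem_nhds hy)).of_le (by norm_num)
  ext i j
  have h1 : pderiv j (pderiv i u) x = pderiv i (pderiv j u) x := pderiv_comm (hu2 x hx) j i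
  have h2 : pderiv l (pderiv j (pderiv i u)) x = pderiv l (pderiv i (pderiv j u)) x := by
    have : pderiv j (pderiv i u) =ᶠ[𝓝 x] pderiv i (pderiv j u) := by
      filter_upwards [hΩ.mem_nhds hx] with y hy using pderiv_comm (hu2 y hy) j i
    rw [pderiv, this.fderiv_eq]
    rfl
  have h3 : (1 : Matrix (Fin n) (Fin n) ℝ) j i = (1 : Matrix (Fin n) (Fin n) ℝ) i j := by
    simp [Matrix.one_apply, eq_comm]
  simp only [dHessianField, Matrix.transpose_apply, Matrix.of_apply, h1, h2, h3]
  ring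

/-- Commuting covariant derivatives of ∇u produces a curvature term, and constant curvature K makes
it cancel against the derivative of K u g. In coordinates the third derivatives cancel by symmetry,
and the rest follows from κ q = K/2 and K|x|² = 4(q - 1), where κ = K/(2q). -/
theorem dHessianField_codazzi (hq : confDen K x ≠ 0) (hu : ContDiffAt ℝ 3 u x) (l i j : Fin n) :
    dHessianField K u x l i j - dHessianField K u x i l j = K / (2 * confDen K x) *
      (x l * hessianField K u x i j - x i * hessianField K u x l j
      - (hessianField K u x *ᵥ fun a => x a) l * (1 : Matrix (Fin n) (Fin n) ℝ) i j
      + (hessianField K u x *ᵥ fun a => x a) i * (1 : Matrix (Fin n) (Fin n) ℝ) l j) := by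
  have h1 : ContDiffAt ℝ 2 (pderiv j u) x := contDiffAt_pderiv (hu.of_le (by norm_num)) j
  have t1 : pderiv l (pderiv i (pderiv j u)) x = pderiv i (pderiv l (pderiv j u)) x :=
    pderiv_comm h1 l i
  have t2 : ∀ a b, pderiv a (pderiv b u) x = pderiv b (pderiv a u) x :=
    pderiv_comm (hu.of_le (by norm_num))
  have t3 : (1 : Matrix (Fin n) (Fin n) ℝ) l i = (1 : Matrix (Fin n) (Fin n) ℝ) i l := by
    simp [Matrix.one_apply, eq_comm]
  have hs : K * ∑ a, x a * x a = 4 * (confDen K x - 1) := by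
    rw [sum_coord_mul_self, confDen]; ring
  have hκ : K / (2 * confDen K x) * confDen K x = K / 2 := by field_simp
  simp only [hessianField, shiftedHessian_mulVec]
  simp only [dHessianField, shiftedHessian, Matrix.of_apply, t1, t3, t2 l i]
  have hc1 : ∀ a, ∑ b, pderiv a (pderiv b u) x * x b = ∑ b, x b * pderiv a (pderiv b u) x :=
    fun a => Finset.sum_congr rfl fun b _ => mul_comm _ _
  have hc2 : ∑ b, pderiv b u x * x b = ∑ b, x b * pderiv b u x :=
    Finset.sum_congr rfl fun b _ => mul_comm _ _
  simp only [hc1, hc2]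
  generalize K / (2 * confDen K x) = κ at *
  generalize confDen K x = q at *
  generalize ∑ a, x a * x a = s at *
  generalize ∑ b, x b * pderiv l (pderiv b u) x = Hl
  generalize ∑ b, x b * pderiv i (pderiv b u) x = Hi
  generalize ∑ b, x b * pderiv b u x = xp
  generalize (1 : Matrix (Fin n) (Fin n) ℝ) i j = δij
  generalize (1 : Matrix (Fin n) (Fin n) ℝ) l j = δlj
  generalize pderiv l u x = pl at *
  generalize pderiv i u x = pi at *
  generalize pderiv j u x = pj at *
  generalize pderiv i (pderiv j u) x = Hij at *
  generalize pderiv l (pderiv j u) x = Hlj at *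
  linear_combination -(q * (x l * Hij - x i * Hlj) + K / 2 * (x l * (x j * pi - xp * δij)
    - x i * (x j * pl - xp * δlj)) - (q * Hl + K / 2 * s * pl) * δij
    + (q * Hi + K / 2 * s * pi) * δlj) * hκ + K / 4 * (pl * δij - pi * δlj) * hs

/-- The gradient of `|∇u|² + K u²` is twice `(∇²u + K u g)(∇u)`. -/
theorem hasLineDerivAt_gradient_function (hu : ContDiffAt ℝ 2 u x) (i : Fin n) :
    HasLineDerivAt ℝ (fun y => confDen K y ^ 2 * ∑ j, pderiv j u y ^ 2 + K * u y ^ 2)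
      (2 * (hessianField K u x *ᵥ fun j => pderiv j u x) i) x (EuclideanSpace.single i 1) := by
  have h1 : ∀ a, ContDiffAt ℝ 1 (pderiv a u) x := fun a =>
    contDiffAt_pderiv (hu.of_le (by norm_num)) a
  have d0 := (hu.differentiableAt (by norm_num)).hasLineDerivAt_pderiv i
  have d1 := fun a => ((h1 a).differentiableAt (by norm_num)).hasLineDerivAt_pderiv i
  have dq : HasLineDerivAt ℝ (confDen K) (K * x i / 2) x (EuclideanSpace.single i 1) :=
    hasLineDerivAt_confDen i
  have := ((dq.fun_pow 2).fun_mul (HasLineDerivAt.fun_sum (s := Finset.univ) fun m _ =>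
    (d1 m).fun_pow 2)).fun_add ((d0.fun_pow 2).fun_const_mul K)
  refine HasLineDerivAt.congr_val this ?_
  rw [hessianField, shiftedHessian_mulVec]
  have e1 : ∑ m, ((2 : ℕ) : ℝ) * pderiv m u x ^ (2 - 1) * pderiv i (pderiv m u) x =
      2 * ∑ m, pderiv i (pderiv m u) x * pderiv m u x := by
    rw [Finset.mul_sum]
    exact Finset.sum_congr rfl fun m _ => by push_cast; ring
  have e2 : ∑ m, pderiv m u x ^ 2 = ∑ m, pderiv m u x * pderiv m u x :=
    Finset.sum_congr rfl fun m _ => sq _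
  rw [e1, e2]
  simp only [Matrix.of_apply]
  push_cast
  ring

end ShiftedHessian

/-! ### The divergence identity -/

section DivergenceIdentity

open Matrix

variable {n : ℕ} {K : ℝ} {x : EuclideanSpace ℝ (Fin n)} {u : EuclideanSpace ℝ (Fin n) → ℝ}
  {Ω : Set (EuclideanSpace ℝ (Fin n))}

/-- The density `√det g` times the components of `Tₘ X`, where `X = f ∂ᵣ` has the coordinates
`xⁱ` and `Tₘ` is the Newton tensor of `g⁻¹(∇²u + K u g)`. -/
noncomputable def newtonField (K : ℝ) (u : EuclideanSpace ℝ (Fin n) → ℝ) (m : ℕ) (i : Fin n)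
    (x : EuclideanSpace ℝ (Fin n)) : ℝ :=
  (confDen K x)⁻¹ ^ n * ∑ j, newtonTensor m (hessianField K u x) i j * x j

theorem contDiffOn_hessianField (hΩ : IsOpen Ω) (hu : ContDiffOn ℝ 3 u Ω) (i j : Fin n) :
    ContDiffOn ℝ 1 (fun y => hessianField K u y i j) Ω := by
  intro y hy
  have hu' := hu.contDiffAt (hΩ.mem_nhds hy)
  have h1 : ∀ a, ContDiffAt ℝ 2 (pderiv a u) y := fun a =>
    contDiffAt_pderiv (hu'.of_le (by norm_num)) a
  have h1' : ∀ a, ContDiffAt ℝ 1 (pderiv a u) y := fun a => (h1 a).of_le (by norm_num)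
  have h2 : ContDiffAt ℝ 1 (pderiv i (pderiv j u)) y :=
    contDiffAt_pderiv ((h1 j).of_le (by norm_num)) i
  have h0 : ContDiffAt ℝ 1 u y := hu'.of_le (by norm_num)
  have hq : ContDiffAt ℝ 1 (confDen K) y := contDiff_confDen.contDiffAt
  have hc : ∀ a, ContDiffAt ℝ 1 (fun y : EuclideanSpace ℝ (Fin n) => y a) y := fun a => by fun_prop
  refine ContDiffAt.contDiffWithinAt ?_
  simp only [hessianField, shiftedHessian, Matrix.of_apply]
  exact (((hq.pow 2).mul h2).add ((contDiffAt_const.mul hq).mul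
    ((((hc i).mul (h1' j)).add ((hc j).mul (h1' i))).sub
      ((ContDiffAt.sum fun l _ => (hc l).mul (h1' l)).mul contDiffAt_const)))).add
    ((contDiffAt_const.mul h0).mul contDiffAt_const)

theorem contDiffOn_newtonField (hΩ : IsOpen Ω) (hq : ∀ y ∈ Ω, confDen K y ≠ 0)
    (hu : ContDiffOn ℝ 3 u Ω) (m : ℕ) (i : Fin n) : ContDiffOn ℝ 1 (newtonField K u m i) Ω := by
  have h := (contDiffOn_elemSymm_newtonTensor (contDiffOn_hessianField (K := K) hΩ hu) m).2
  refine ((contDiff_confDen.contDiffOn.inv hq).pow n).mul (ContDiffOn.sum fun j _ => (h i j).mul ?_)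
  exact ContDiff.contDiffOn (by fun_prop)

/-- `div (Tₘ X) = (n - m) σₘ V`. -/
theorem sum_pderiv_newtonField (hΩ : IsOpen Ω) (hq : ∀ y ∈ Ω, confDen K y ≠ 0)
    (hu : ContDiffOn ℝ 3 u Ω) (hx : x ∈ Ω) (m : ℕ) :
    ∑ i, pderiv i (newtonField K u m i) x = (confDen K x)⁻¹ ^ n * ((n - m) *
      elemSymm m (hessianField K u x) * ((1 - K * ‖x‖ ^ 2 / 4) / confDen K x)) := by
  have hx' := hΩ.mem_nhds hx
  have hux := hu.contDiffAt hx'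
  have hsm := fun m => contDiffOn_elemSymm_newtonTensor (contDiffOn_hessianField (K := K) hΩ hu) m
  have hT : ∀ m a b, DifferentiableAt ℝ (fun y => newtonTensor m (hessianField K u y) a b) x :=
    fun m a b => (((hsm m).2 a b).contDiffAt hx').differentiableAt one_ne_zero
  have hs : ∀ m, DifferentiableAt ℝ (fun y => elemSymm m (hessianField K u y)) x :=
    fun m => ((hsm m).1.contDiffAt hx').differentiableAt one_ne_zero
  have hdiv := sum_pderiv_newtonTensor hs hT (hessianField_transpose (hux.of_le (by norm_num)))
    (hasLineDerivAt_hessianField hux) (dHessianField_transpose hΩ hu hx) (fun a => x a)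
    (K / (2 * confDen K x)) (dHessianField_codazzi (hq x hx) hux) m
  set T := newtonTensor m (hessianField K u x) with hTdef
  have hqx := hq x hx
  -- The power rule leaves the truncated exponent n - 1; for n = 0 the factor n makes both sides
  -- zero.
  have hpow : (n : ℝ) * (confDen K x)⁻¹ ^ (n - 1) * (confDen K x)⁻¹ =
      n * (confDen K x)⁻¹ ^ n := by
    rcases Nat.eq_zero_or_pos n with h | h
    · simp [h]
    · rw [mul_assoc, ← pow_succ, Nat.sub_add_cancel h]
  have hder : ∀ i, pderiv i (newtonField K u m i) x =
      (confDen K x)⁻¹ ^ n * (-(n * (K / (2 * confDen K x))) * (x i * (T *ᵥ fun a => x a) i)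
        + (∑ j, pderiv i (fun y => newtonTensor m (hessianField K u y) i j) x * x j + T i i)) := by
    intro i
    refine HasLineDerivAt.pderiv_eq ?_
      (((contDiffOn_newtonField hΩ hq hu m i).contDiffAt hx').differentiableAt one_ne_zero)
    have := (((hasLineDerivAt_confDen i).fun_inv hqx).fun_pow n).fun_mul
      (HasLineDerivAt.fun_sum (s := Finset.univ) fun j _ =>
        ((hT m i j).hasLineDerivAt_pderiv i).fun_mul (hasLineDerivAt_coord (x := x) i j))
    refine HasLineDerivAt.congr_val this ?_
    have e1 : ∑ j, T i j * (1 : Matrix (Fin n) (Fin n) ℝ) i j = T i i := by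
      simp [Matrix.one_apply]
    have e2 : (T *ᵥ fun a => x a) i = ∑ j, T i j * x j := rfl
    rw [Finset.sum_add_distrib, e1, ← e2]
    have e3 : -(K * x i / 2) / confDen K x ^ 2 =
        (confDen K x)⁻¹ * (-(K / (2 * confDen K x)) * x i) := by
      field_simp
    rw [e3, ← mul_assoc, hpow]
    ring
  simp only [hder]
  rw [← Finset.mul_sum, Finset.sum_add_distrib, Finset.sum_add_distrib, ← Finset.mul_sum]
  have e4 : ∑ i, ∑ j, pderiv i (fun y => newtonTensor m (hessianField K u y) i j) x * x j =
      K / (2 * confDen K x) * (n * ∑ j, x j * (T *ᵥ fun a => x a) j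
        - (n - m) * elemSymm m (hessianField K u x) * ‖x‖ ^ 2) := by
    rw [Finset.sum_comm]
    simp only [← Finset.sum_mul, hdiv]
    rw [← sum_coord_mul_self, Finset.mul_sum, Finset.mul_sum, ← Finset.sum_sub_distrib,
      Finset.mul_sum]
    exact Finset.sum_congr rfl fun j _ => by ring
  have e5 : ∑ i, T i i = (n - m) * elemSymm m (hessianField K u x) := by
    have := trace_newtonTensor (hessianField K u x) m
    rw [Fintype.card_fin] at this
    exact this
  rw [e4, e5]
  congr 1
  -- This is V = 1 - κ|x|² with κ = K/(2q). The terms nκ x·Tx from the density q⁻ⁿ and from div T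
  -- cancel, leaving tr T (1 - κ|x|²).
  have e6 : (1 - K * ‖x‖ ^ 2 / 4) / confDen K x = 1 - K / (2 * confDen K x) * ‖x‖ ^ 2 := by
    rw [div_eq_iff hqx, sub_mul, one_mul]
    have : K / (2 * confDen K x) * ‖x‖ ^ 2 * confDen K x = K * ‖x‖ ^ 2 / 2 := by field_simp
    rw [this, confDen]
    ring
  rw [e6]
  ring

/-- The vector field `(P - c') Tₖ X - 2 (u - c) Tₖ A X` with `P = |∇u|² + K u²`, multiplied by
`√det g`, on the set where `σₖ₊₁ = s`. -/
noncomputable def boundaryField (K c c' s : ℝ) (u : EuclideanSpace ℝ (Fin n) → ℝ) (k : ℕ)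
    (i : Fin n) (x : EuclideanSpace ℝ (Fin n)) : ℝ :=
  (confDen K x ^ 2 * ∑ j, pderiv j u x ^ 2 + K * u x ^ 2 - c') * newtonField K u k i x
    - 2 * ((u x - c) * (s * newtonField K u 0 i x - newtonField K u (k + 1) i x))

theorem contDiffOn_gradient_function (hΩ : IsOpen Ω) (hu : ContDiffOn ℝ 3 u Ω) :
    ContDiffOn ℝ 1 (fun y => confDen K y ^ 2 * ∑ j, pderiv j u y ^ 2 + K * u y ^ 2) Ω := by
  intro y hy
  have hu' := hu.contDiffAt (hΩ.mem_nhds hy)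
  have h1 : ∀ a, ContDiffAt ℝ 1 (pderiv a u) y := fun a =>
    contDiffAt_pderiv (hu'.of_le (by norm_num)) a
  have h0 : ContDiffAt ℝ 1 u y := hu'.of_le (by norm_num)
  exact (((contDiff_confDen.contDiffAt.pow 2).mul (ContDiffAt.sum fun j _ => (h1 j).pow 2)).add
    (contDiffAt_const.mul (h0.pow 2))).contDiffWithinAt

theorem contDiffOn_boundaryField (hΩ : IsOpen Ω) (hq : ∀ y ∈ Ω, confDen K y ≠ 0)
    (hu : ContDiffOn ℝ 3 u Ω) (c c' s : ℝ) (k : ℕ) (i : Fin n) :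
    ContDiffOn ℝ 1 (boundaryField K c c' s u k i) Ω :=
  (((contDiffOn_gradient_function hΩ hu).sub contDiffOn_const).mul
    (contDiffOn_newtonField hΩ hq hu k i)).sub (contDiffOn_const.mul
    (((hu.of_le (by norm_num)).sub contDiffOn_const).mul
      ((contDiffOn_const.mul (contDiffOn_newtonField hΩ hq hu 0 i)).sub
        (contDiffOn_newtonField hΩ hq hu (k + 1) i))))

/-- The gradient terms cancel because A is symmetric and ∇P = 2A∇u. The factor k + 1 is n - (n - k -
1), from div X = nV and div(Tₖ₊₁ X) = (n - k - 1) s V. No derivative of A survives, so the right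
side makes sense for u of class C². -/
theorem sum_pderiv_boundaryField (hΩ : IsOpen Ω) (hq : ∀ y ∈ Ω, confDen K y ≠ 0)
    (hu : ContDiffOn ℝ 3 u Ω) (hx : x ∈ Ω) (c c' : ℝ) {s : ℝ} (k : ℕ)
    (hs : elemSymm (k + 1) (hessianField K u x) = s) :
    ∑ i, pderiv i (boundaryField K c c' s u k i) x =
      (confDen K x)⁻¹ ^ n * ((1 - K * ‖x‖ ^ 2 / 4) / confDen K x) *
      ((n - k) * ((confDen K x ^ 2 * ∑ j, pderiv j u x ^ 2 + K * u x ^ 2 - c') *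
        elemSymm k (hessianField K u x)) - 2 * (k + 1) * s * (u x - c)) := by
  have hx' := hΩ.mem_nhds hx
  have hux := hu.contDiffAt hx'
  set A := hessianField K u x with hA
  set X : Fin n → ℝ := fun a => x a with hX
  set p : Fin n → ℝ := fun j => pderiv j u x with hp
  have hAt : Aᵀ = A := hessianField_transpose (hux.of_le (by norm_num))
  have hZ : ∀ m i, newtonField K u m i x = (confDen K x)⁻¹ ^ n * (newtonTensor m A *ᵥ X) i :=
    fun m i => rfl
  have hdZ : ∀ m i, DifferentiableAt ℝ (newtonField K u m i) x := fun m i =>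
    ((contDiffOn_newtonField hΩ hq hu m i).contDiffAt hx').differentiableAt one_ne_zero
  have hder : ∀ i, pderiv i (boundaryField K c c' s u k i) x =
      2 * (A *ᵥ p) i * newtonField K u k i x
      + (confDen K x ^ 2 * ∑ j, pderiv j u x ^ 2 + K * u x ^ 2 - c')
        * pderiv i (newtonField K u k i) x
      - 2 * (p i * (s * newtonField K u 0 i x - newtonField K u (k + 1) i x)
        + (u x - c) * (s * pderiv i (newtonField K u 0 i) x
          - pderiv i (newtonField K u (k + 1) i) x)) := by
    intro i
    refine HasLineDerivAt.pderiv_eq ?_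
      (((contDiffOn_boundaryField hΩ hq hu c c' s k i).contDiffAt hx').differentiableAt one_ne_zero)
    have d0 := (hux.differentiableAt (by norm_num)).hasLineDerivAt_pderiv i
    have dZ := fun m => (hdZ m i).hasLineDerivAt_pderiv i
    have := (((hasLineDerivAt_gradient_function (K := K) (hux.of_le (by norm_num)) i).fun_sub
      (HasLineDerivAt.fun_const c')).fun_mul (dZ k)).fun_sub
      (((d0.fun_sub (HasLineDerivAt.fun_const c)).fun_mul
        (((dZ 0).fun_const_mul s).fun_sub (dZ (k + 1)))).fun_const_mul 2)
    refine HasLineDerivAt.congr_val this ?_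
    simp only [hp, hA]
    ring
  have e1 : ∑ i, (A *ᵥ p) i * newtonField K u k i x =
      ∑ i, p i * (s * newtonField K u 0 i x - newtonField K u (k + 1) i x) := by
    -- Here σₖ₊₁ = s identifies s X - Tₖ₊₁ X with A Tₖ X; as T₀ = 1, the field `newtonField K u 0`
    -- is the weighted X.
    have e2 : ∀ i, s * newtonField K u 0 i x - newtonField K u (k + 1) i x =
        (confDen K x)⁻¹ ^ n * (A *ᵥ (newtonTensor k A *ᵥ X)) i := by
      intro i
      rw [hZ, hZ, Matrix.mulVec_mulVec, ← newtonTensor_commute, newtonTensor_mul_self, hs,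
        Matrix.sub_mulVec, Matrix.smul_mulVec]
      simp [newtonTensor]
      ring
    simp only [e2]
    simp only [hZ]
    have e3 : (A *ᵥ p) ⬝ᵥ (newtonTensor k A *ᵥ X) = p ⬝ᵥ (A *ᵥ (newtonTensor k A *ᵥ X)) := by
      rw [Matrix.dotProduct_mulVec p, ← Matrix.mulVec_transpose, hAt]
    simp only [mul_left_comm _ ((confDen K x)⁻¹ ^ n), ← Finset.mul_sum]
    exact congrArg _ e3
  have e4 : ∑ i, pderiv i (boundaryField K c c' s u k i) x =
      2 * ∑ i, (A *ᵥ p) i * newtonField K u k i x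
      + (confDen K x ^ 2 * ∑ j, pderiv j u x ^ 2 + K * u x ^ 2 - c')
        * ∑ i, pderiv i (newtonField K u k i) x
      - 2 * (∑ i, p i * (s * newtonField K u 0 i x - newtonField K u (k + 1) i x)
        + (u x - c) * (s * ∑ i, pderiv i (newtonField K u 0 i) x
          - ∑ i, pderiv i (newtonField K u (k + 1) i) x)) := by
    simp only [hder]
    rw [Finset.sum_sub_distrib, Finset.sum_add_distrib, ← Finset.mul_sum, ← Finset.mul_sum,
      Finset.sum_add_distrib, ← Finset.mul_sum, Finset.sum_sub_distrib, ← Finset.mul_sum]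
    simp only [mul_assoc, ← Finset.mul_sum]
  rw [e4, e1, sum_pderiv_newtonField hΩ hq hu hx, sum_pderiv_newtonField hΩ hq hu hx,
    sum_pderiv_newtonField hΩ hq hu hx, ← hA, hs, elemSymm_zero]
  push_cast
  ring

end DivergenceIdentity

/-! ### Functions with a continuous extension to the closure -/

section ContinuousExtension

variable {n : ℕ} {Ω : Set (EuclideanSpace ℝ (Fin n))} {f g : EuclideanSpace ℝ (Fin n) → ℝ}

/-- `f` agrees on `Ω` with a function which is continuous on the closure of `Ω`. -/
def ExtendsToClosure (Ω : Set (EuclideanSpace ℝ (Fin n))) (f : EuclideanSpace ℝ (Fin n) → ℝ) :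
    Prop :=
  ∃ g, ContinuousOn g (closure Ω) ∧ EqOn f g Ω

namespace ExtendsToClosure

theorem of_continuousOn (h : ContinuousOn f (closure Ω)) : ExtendsToClosure Ω f :=
  ⟨f, h, fun _ _ => rfl⟩

theorem const (c : ℝ) : ExtendsToClosure Ω fun _ => c := of_continuousOn continuousOn_const

theorem congr (h : ExtendsToClosure Ω f) (hfg : EqOn g f Ω) : ExtendsToClosure Ω g :=
  h.imp fun _ h => ⟨h.1, hfg.trans h.2⟩

theorem add (hf : ExtendsToClosure Ω f) (hg : ExtendsToClosure Ω g) :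
    ExtendsToClosure Ω fun x => f x + g x := by
  obtain ⟨f', hf, hf'⟩ := hf
  obtain ⟨g', hg, hg'⟩ := hg
  exact ⟨_, hf.add hg, fun x hx => congrArg₂ _ (hf' hx) (hg' hx)⟩

theorem sub (hf : ExtendsToClosure Ω f) (hg : ExtendsToClosure Ω g) :
    ExtendsToClosure Ω fun x => f x - g x := by
  obtain ⟨f', hf, hf'⟩ := hf
  obtain ⟨g', hg, hg'⟩ := hg
  exact ⟨_, hf.sub hg, fun x hx => congrArg₂ _ (hf' hx) (hg' hx)⟩

theorem mul (hf : ExtendsToClosure Ω f) (hg : ExtendsToClosure Ω g) :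
    ExtendsToClosure Ω fun x => f x * g x := by
  obtain ⟨f', hf, hf'⟩ := hf
  obtain ⟨g', hg, hg'⟩ := hg
  exact ⟨_, hf.mul hg, fun x hx => congrArg₂ _ (hf' hx) (hg' hx)⟩

theorem pow (hf : ExtendsToClosure Ω f) (m : ℕ) : ExtendsToClosure Ω fun x => f x ^ m := by
  obtain ⟨f', hf, hf'⟩ := hf
  exact ⟨_, hf.pow m, fun x hx => congrArg (· ^ m) (hf' hx)⟩

theorem sum {ι : Type*} {s : Finset ι} {f : ι → EuclideanSpace ℝ (Fin n) → ℝ}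
    (hf : ∀ i, ExtendsToClosure Ω (f i)) : ExtendsToClosure Ω fun x => ∑ i ∈ s, f i x := by
  choose g hg hfg using hf
  exact ⟨fun x => ∑ i ∈ s, g i x, continuousOn_finsetSum _ fun i _ => hg i,
    fun x hx => Finset.sum_congr rfl fun i _ => hfg i hx⟩

theorem exists_bound (hf : ExtendsToClosure Ω f) (hΩ : Bornology.IsBounded Ω) :
    ∃ C, 0 ≤ C ∧ ∀ x ∈ Ω, |f x| ≤ C := by
  obtain ⟨g, hg, hfg⟩ := hf
  obtain ⟨C, hC⟩ := hΩ.isCompact_closure.exists_bound_of_continuousOn hg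
  refine ⟨max C 0, le_max_right _ _, fun x hx => ?_⟩
  rw [hfg hx]
  exact (hC x (subset_closure hx)).trans (le_max_left _ _)

theorem integrableOn (hf : ExtendsToClosure Ω f) (hΩ : Bornology.IsBounded Ω) (hΩo : IsOpen Ω) :
    IntegrableOn f Ω := by
  obtain ⟨g, hg, hfg⟩ := hf
  exact ((hg.integrableOn_compact hΩ.isCompact_closure).mono_set subset_closure).congr_fun
    hfg.symm hΩo.measurableSet

/-- Extend the entries, then use the smoothness lemma with N = 0 for the extended matrix. -/
theorem elemSymm_newtonTensor {A : EuclideanSpace ℝ (Fin n) → Matrix (Fin n) (Fin n) ℝ}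
    (hA : ∀ i j, ExtendsToClosure Ω fun x => A x i j) (m : ℕ) :
    ExtendsToClosure Ω (fun x => elemSymm m (A x)) ∧
      ∀ i j, ExtendsToClosure Ω fun x => newtonTensor m (A x) i j := by
  choose B hB hAB using hA
  have h := contDiffOn_elemSymm_newtonTensor (N := 0) (A := fun x => Matrix.of fun i j => B i j x)
    (fun i j => contDiffOn_zero.2 (hB i j)) m
  have hAB' : ∀ x ∈ Ω, A x = Matrix.of fun i j => B i j x := fun x hx =>
    Matrix.ext fun i j => hAB i j hx
  exact ⟨⟨_, h.1.continuousOn, fun x hx => by simp only [hAB' x hx]⟩,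
    fun i j => ⟨_, (h.2 i j).continuousOn, fun x hx => by simp only [hAB' x hx]⟩⟩

theorem confDen {K : ℝ} : ExtendsToClosure Ω (confDen K) :=
  of_continuousOn (contDiff_confDen (N := 0)).continuous.continuousOn

theorem coord (i : Fin n) : ExtendsToClosure Ω fun x => x i :=
  of_continuousOn (Continuous.continuousOn (by fun_prop))

end ExtendsToClosure

theorem contDiffOn_fderivWithin_closure {m N : WithTop ℕ∞} (hS : UniqueDiffOn ℝ (closure Ω))
    (hf : ContDiffOn ℝ N f (closure Ω)) (hm : m + 1 ≤ N) (i : Fin n) :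
    ContDiffOn ℝ m (fun x => fderivWithin ℝ f (closure Ω) x (EuclideanSpace.single i 1))
      (closure Ω) :=
  (hf.fderivWithin hS hm).clm_apply contDiffOn_const

/-- Identifies interior derivatives with derivatives within the closure, whose continuity up to ∂Ω
is known. Requiring f = g only on Ω lets the lemma be iterated for second derivatives. -/
theorem pderiv_eqOn_fderivWithin_closure (hΩ : IsOpen Ω) (hfg : EqOn f g Ω) (i : Fin n) :
    EqOn (pderiv i f) (fun x => fderivWithin ℝ g (closure Ω) x (EuclideanSpace.single i 1)) Ω := by
  intro x hx
  have h1 : f =ᶠ[𝓝 x] g := hfg.eventuallyEq_of_mem (hΩ.mem_nhds hx)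
  have h2 : closure Ω ∈ 𝓝 x := mem_of_superset (hΩ.mem_nhds hx) subset_closure
  rw [pderiv, h1.fderiv_eq]
  simp only [fderivWithin_of_mem_nhds h2]

end ContinuousExtension

/-! ### Integration against the Riemannian volume -/

section Volume

variable {n : ℕ} {K : ℝ} {Ω : Set (EuclideanSpace ℝ (Fin n))} {f : EuclideanSpace ℝ (Fin n) → ℝ}

theorem measurable_volumeDensity : Measurable fun x : EuclideanSpace ℝ (Fin n) =>
    ENNReal.ofReal (Real.sqrt (spaceFormMetric K x).det) := by
  have h : Measurable (confDen K : EuclideanSpace ℝ (Fin n) → ℝ) :=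
    (contDiff_confDen (N := 0)).continuous.measurable
  simp only [spaceFormMetric_eq, Matrix.det_smul, Matrix.det_one, mul_one]
  exact (((h.pow_const 2).inv.pow_const _).sqrt).ennreal_ofReal

theorem restrict_riemVolume (hΩ : IsOpen Ω) : (riemVolume (spaceFormMetric K)).restrict Ω =
    (volume.restrict Ω).withDensity fun x => ENNReal.ofReal (Real.sqrt (spaceFormMetric K x).det) :=
  restrict_withDensity hΩ.measurableSet _

theorem integrableOn_riemVolume (hΩ : IsOpen Ω) (hq : ∀ x ∈ Ω, 0 < confDen K x)
    (hf : IntegrableOn (fun x => (confDen K x)⁻¹ ^ n * f x) Ω) :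
    IntegrableOn f Ω (riemVolume (spaceFormMetric K)) := by
  rw [IntegrableOn, restrict_riemVolume hΩ,
    integrable_withDensity_iff_integrable_smul' measurable_volumeDensity (by simp)]
  refine IntegrableOn.congr_fun hf (fun x hx => ?_) hΩ.measurableSet
  rw [ENNReal.toReal_ofReal (Real.sqrt_nonneg _), sqrt_det_spaceFormMetric (hq x hx), smul_eq_mul]

theorem setIntegral_riemVolume (hΩ : IsOpen Ω) (hq : ∀ x ∈ Ω, 0 < confDen K x) :
    ∫ x in Ω, f x ∂(riemVolume (spaceFormMetric K)) = ∫ x in Ω, (confDen K x)⁻¹ ^ n * f x := by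
  rw [restrict_riemVolume hΩ, integral_withDensity_eq_integral_toReal_smul
    measurable_volumeDensity (by simp)]
  refine setIntegral_congr_fun hΩ.measurableSet fun x hx => ?_
  rw [ENNReal.toReal_ofReal (Real.sqrt_nonneg _), sqrt_det_spaceFormMetric (hq x hx), smul_eq_mul]

end Volume

/-! ### Divergence of fields whose coefficients vanish on the boundary -/

section Identity

variable {n : ℕ} {K : ℝ} {u : EuclideanSpace ℝ (Fin n) → ℝ} {Ω : Set (EuclideanSpace ℝ (Fin n))}

/-- The total divergence of a `C¹` vector field `a R + b Z` is zero if the functions `a` and `b`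
vanish on the boundary. -/
theorem setIntegral_divergence_eq_zero_of_combination (hΩo : IsOpen Ω)
    (hΩb : Bornology.IsBounded Ω) {a b : EuclideanSpace ℝ (Fin n) → ℝ}
    {W R Z : Fin n → EuclideanSpace ℝ (Fin n) → ℝ}
    {D : EuclideanSpace ℝ (Fin n) → ℝ} (ha : ContDiffOn ℝ 1 a Ω) (hb : ContDiffOn ℝ 1 b Ω)
    (hab : ∃ a' b' : EuclideanSpace ℝ (Fin n) → ℝ, ContinuousOn a' (closure Ω) ∧
      ContinuousOn b' (closure Ω) ∧ EqOn a a' Ω ∧ EqOn b b' Ω ∧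
      ∀ x ∈ frontier Ω, a' x = 0 ∧ b' x = 0)
    (hW : ∀ i, ContDiffOn ℝ 1 (W i) Ω) (hWab : ∀ i x, W i x = a x * R i x + b x * Z i x)
    (hR : ∀ i, ExtendsToClosure Ω (R i)) (hZ : ∀ i, ExtendsToClosure Ω (Z i))
    (hda : ∀ i, ExtendsToClosure Ω (pderiv i a)) (hdb : ∀ i, ExtendsToClosure Ω (pderiv i b))
    (hD : ExtendsToClosure Ω D) (hdiv : ∀ x ∈ Ω, ∑ i, pderiv i (W i) x = D x)
    (hD0 : ∀ x ∈ Ω, a x = 0 → b x = 0 → D x = 0) : ∫ x in Ω, D x = 0 := by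
  obtain ⟨a', b', ha', hb', haa', hbb', hab0⟩ := hab
  obtain ⟨C₀, hC₀, hDC⟩ := hD.exists_bound hΩb
  obtain ⟨C₁, hC₁, h1⟩ := (ExtendsToClosure.sum (s := Finset.univ)
    fun i => (hda i).mul (hR i)).exists_bound hΩb
  obtain ⟨C₂, hC₂, h2⟩ := (ExtendsToClosure.sum (s := Finset.univ)
    fun i => ((hda i).mul (hZ i)).add ((hdb i).mul (hR i))).exists_bound hΩb
  obtain ⟨C₃, hC₃, h3⟩ := (ExtendsToClosure.sum (s := Finset.univ)
    fun i => (hdb i).mul (hZ i)).exists_bound hΩb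
  have hdw : ∀ x ∈ Ω, ∀ i, pderiv i (fun x => a x ^ 2 + b x ^ 2) x =
      2 * a x * pderiv i a x + 2 * b x * pderiv i b x := by
    intro x hx i
    have hda := (ha.contDiffAt (hΩo.mem_nhds hx)).differentiableAt one_ne_zero
    have hdb := (hb.contDiffAt (hΩo.mem_nhds hx)).differentiableAt one_ne_zero
    refine HasLineDerivAt.pderiv_eq ?_ ((hda.pow 2).add (hdb.pow 2))
    refine (((hda.hasLineDerivAt_pderiv i).fun_pow 2).fun_add
      ((hdb.hasLineDerivAt_pderiv i).fun_pow 2)).congr_val ?_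
    push_cast
    ring
  -- The choice w = a² + b² makes ∇w · W a quadratic form in (a, b) with bounded coefficients, hence
  -- O(w). In the constant, C₀ bounds the divergence and the other terms bound that form.
  have hmain := setIntegral_divergence_eq_zero (w := fun x => a x ^ 2 + b x ^ 2) (W := W)
    (C := C₀ + (2 * C₁ + C₂ + 2 * C₃)) hΩo hΩb ((ha.pow 2).add (hb.pow 2))
    (fun x _ => by positivity) ?_ hW ?_ ?_ ?_
  · rw [← hmain]
    exact setIntegral_congr_fun hΩo.measurableSet fun x hx => (hdiv x hx).symm
  · intro ε hε
    -- The extensions vanish on ∂Ω, so the superlevel set taken in the closure never touches the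
    -- boundary and is compact.
    have hset : {x | x ∈ Ω ∧ ε ≤ a x ^ 2 + b x ^ 2} =
        closure Ω ∩ (fun x => a' x ^ 2 + b' x ^ 2) ⁻¹' Ici ε := by
      ext x
      constructor
      · rintro ⟨hx, h⟩
        rw [haa' hx, hbb' hx] at h
        exact ⟨subset_closure hx, h⟩
      · rintro ⟨hx, h⟩
        have hxΩ : x ∈ Ω := by
          by_contra hx'
          obtain ⟨h0, h0'⟩ := hab0 x (by rw [hΩo.frontier_eq]; exact ⟨hx, hx'⟩)
          simp only [mem_preimage, mem_Ici, h0, h0'] at h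
          norm_num at h
          exact absurd h hε.not_ge
        refine ⟨hxΩ, ?_⟩
        rw [haa' hxΩ, hbb' hxΩ]
        exact h
    rw [hset]
    exact hΩb.isCompact_closure.of_isClosed_subset
      (((ha'.pow 2).add (hb'.pow 2)).preimage_isClosed_of_isClosed isClosed_closure isClosed_Ici)
      inter_subset_left
  · intro x hx
    have hsum : ∑ i, pderiv i (fun x => a x ^ 2 + b x ^ 2) x * W i x =
        2 * a x ^ 2 * (∑ i, pderiv i a x * R i x)
        + 2 * (a x * b x) * (∑ i, (pderiv i a x * Z i x + pderiv i b x * R i x))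
        + 2 * b x ^ 2 * ∑ i, pderiv i b x * Z i x := by
      rw [Finset.mul_sum, Finset.mul_sum, Finset.mul_sum, ← Finset.sum_add_distrib,
        ← Finset.sum_add_distrib]
      refine Finset.sum_congr rfl fun i _ => ?_
      rw [hdw x hx, hWab]
      ring
    rw [hsum]
    have k1 := h1 x hx
    have k2 := h2 x hx
    have k3 := h3 x hx
    have habs : 2 * |a x * b x| ≤ a x ^ 2 + b x ^ 2 := by
      rw [abs_mul]
      nlinarith [sq_nonneg (|a x| - |b x|), sq_abs (a x), sq_abs (b x)]
    refine (abs_add_le _ _).trans ((add_le_add (abs_add_le _ _) le_rfl).trans ?_)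
    rw [abs_mul, abs_mul _ (∑ i, (_ + _)), abs_mul _ (∑ i, pderiv i b x * Z i x),
      abs_of_nonneg (by positivity : 0 ≤ 2 * a x ^ 2), abs_mul 2, abs_two,
      abs_of_nonneg (by positivity : 0 ≤ 2 * b x ^ 2)]
    have l1 := mul_le_mul_of_nonneg_left k1 (by positivity : 0 ≤ 2 * a x ^ 2)
    have l2 := mul_le_mul habs k2 (abs_nonneg _) (by positivity)
    have l3 := mul_le_mul_of_nonneg_left k3 (by positivity : 0 ≤ 2 * b x ^ 2)
    have l4 : 0 ≤ C₀ * (a x ^ 2 + b x ^ 2) := by positivity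
    have l5 : 0 ≤ 2 * C₁ * b x ^ 2 := by positivity
    have l6 : 0 ≤ 2 * C₃ * a x ^ 2 := by positivity
    linarith
  · intro x hx
    rw [hdiv x hx]
    exact (hDC x hx).trans (by linarith)
  · intro x hx h
    rw [hdiv x hx]
    have h1 : a x ^ 2 = 0 := by linarith [sq_nonneg (a x), sq_nonneg (b x)]
    have h2 : b x ^ 2 = 0 := by linarith [sq_nonneg (a x), sq_nonneg (b x)]
    exact hD0 x hx (pow_eq_zero_iff two_ne_zero |>.1 h1) (pow_eq_zero_iff two_ne_zero |>.1 h2)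

end Identity

/-! ### The integral identity in conformal coordinates -/

section SpaceFormIdentity

variable {n : ℕ} {K : ℝ} {u : EuclideanSpace ℝ (Fin n) → ℝ} {Ω : Set (EuclideanSpace ℝ (Fin n))}

theorem sigmaHess_eq_elemSymm {m : ℕ} (hm : m ≤ n) {x : EuclideanSpace ℝ (Fin n)}
    (hq : confDen K x ≠ 0) (hu : ContDiffAt ℝ 2 u x) :
    sigmaHess (spaceFormMetric K) K m u x = elemSymm m (hessianField K u x) := by
  rw [sigmaHess, inv_spaceFormMetric_mul_riemHessian hq,
    sigmaMat_eq_elemSymm hm (hessianField_transpose hu)]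

theorem extendsToClosure_pderiv (hΩo : IsOpen Ω) (hS : UniqueDiffOn ℝ (closure Ω))
    (hu2 : ContDiffOn ℝ 2 u (closure Ω)) (i : Fin n) : ExtendsToClosure Ω (pderiv i u) :=
  ⟨_, (contDiffOn_fderivWithin_closure (m := 0) hS hu2 (by norm_num) i).continuousOn,
    pderiv_eqOn_fderivWithin_closure hΩo (fun _ _ => rfl) i⟩

theorem extendsToClosure_pderiv_pderiv (hΩo : IsOpen Ω) (hS : UniqueDiffOn ℝ (closure Ω))
    (hu2 : ContDiffOn ℝ 2 u (closure Ω)) (i j : Fin n) :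
    ExtendsToClosure Ω (pderiv i (pderiv j u)) :=
  ⟨_, (contDiffOn_fderivWithin_closure (m := 0) hS
      (contDiffOn_fderivWithin_closure (m := 1) hS hu2 (by norm_num) j) (by norm_num)
      i).continuousOn,
    pderiv_eqOn_fderivWithin_closure hΩo (pderiv_eqOn_fderivWithin_closure hΩo (fun _ _ => rfl) j) i⟩

theorem extendsToClosure_hessianField (hΩo : IsOpen Ω) (hS : UniqueDiffOn ℝ (closure Ω))
    (hu2 : ContDiffOn ℝ 2 u (closure Ω)) (i j : Fin n) :
    ExtendsToClosure Ω fun x => hessianField K u x i j := by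
  have h1 := extendsToClosure_pderiv hΩo hS hu2
  have h2 := extendsToClosure_pderiv_pderiv hΩo hS hu2
  have h0 := ExtendsToClosure.of_continuousOn hu2.continuousOn
  simp only [hessianField, shiftedHessian, Matrix.of_apply]
  exact (((ExtendsToClosure.confDen.pow 2).mul (h2 i j)).add
    (((ExtendsToClosure.const _).mul ExtendsToClosure.confDen).mul
      ((((ExtendsToClosure.coord i).mul (h1 j)).add ((ExtendsToClosure.coord j).mul (h1 i))).sub
        ((ExtendsToClosure.sum fun l => (ExtendsToClosure.coord l).mul (h1 l)).mul
          (ExtendsToClosure.const _))))).add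
    (((ExtendsToClosure.const K).mul h0).mul (ExtendsToClosure.const _))

theorem extendsToClosure_inv_confDen (hq : ∀ x ∈ closure Ω, 0 < confDen K x) :
    ExtendsToClosure Ω fun x => (confDen K x)⁻¹ :=
  ExtendsToClosure.of_continuousOn
    ((contDiff_confDen (N := 0)).continuous.continuousOn.inv₀ fun x hx => (hq x hx).ne')

theorem extendsToClosure_newtonField (hΩo : IsOpen Ω) (hS : UniqueDiffOn ℝ (closure Ω))
    (hq : ∀ x ∈ closure Ω, 0 < confDen K x) (hu2 : ContDiffOn ℝ 2 u (closure Ω)) (m : ℕ)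
    (i : Fin n) : ExtendsToClosure Ω (newtonField K u m i) :=
  ((extendsToClosure_inv_confDen hq).pow n).mul (ExtendsToClosure.sum fun j =>
    ((ExtendsToClosure.elemSymm_newtonTensor
      (extendsToClosure_hessianField hΩo hS hu2) m).2 i j).mul (ExtendsToClosure.coord j))

theorem extendsToClosure_hessianField_mulVec (hΩo : IsOpen Ω) (hS : UniqueDiffOn ℝ (closure Ω))
    (hu2 : ContDiffOn ℝ 2 u (closure Ω)) (i : Fin n) :
    ExtendsToClosure Ω fun x => ((hessianField K u x).mulVec fun j => pderiv j u x) i := by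
  simp only [Matrix.mulVec, dotProduct]
  exact ExtendsToClosure.sum fun j => (extendsToClosure_hessianField hΩo hS hu2 i j).mul
    (extendsToClosure_pderiv hΩo hS hu2 j)

/-- The integrals of the two sides of the identity, in coordinates. -/
theorem setIntegral_coordinate_identity {c c₂ s : ℝ} {k : ℕ} (hΩo : IsOpen Ω)
    (hΩb : Bornology.IsBounded Ω) (hΩ2 : HasC2Boundary Ω)
    (hq : ∀ x ∈ closure Ω, 0 < confDen K x) (hu3 : ContDiffOn ℝ 3 u Ω)
    (hu2 : ContDiffOn ℝ 2 u (closure Ω))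
    (hs : ∀ x ∈ Ω, elemSymm (k + 1) (hessianField K u x) = s)
    (hD : ∀ x ∈ frontier Ω, u x = c)
    (hN : ∀ x ∈ frontier Ω, ∀ ν, IsOutwardUnitNormal (spaceFormMetric K) Ω x ν →
      fderivWithin ℝ u (closure Ω) x ν = c₂) :
    ∫ x in Ω, (confDen K x)⁻¹ ^ n * ((1 - K * ‖x‖ ^ 2 / 4) / confDen K x) *
      ((n - k) * ((confDen K x ^ 2 * ∑ j, pderiv j u x ^ 2 + K * u x ^ 2 - (K * c ^ 2 + c₂ ^ 2)) *
        elemSymm k (hessianField K u x)) - 2 * (k + 1) * s * (u x - c)) = 0 := by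
  have hS := uniqueDiffOn_closure_of_hasC2Boundary hΩo hΩ2
  have hq' : ∀ x ∈ Ω, confDen K x ≠ 0 := fun x hx => (hq x (subset_closure hx)).ne'
  have h0 : ExtendsToClosure Ω u := ExtendsToClosure.of_continuousOn hu2.continuousOn
  have h1 := extendsToClosure_pderiv hΩo hS hu2
  have hZ := fun m => extendsToClosure_newtonField (K := K) hΩo hS hq hu2 m
  have hud : ∀ x ∈ Ω, ContDiffAt ℝ 3 u x := fun x hx => hu3.contDiffAt (hΩo.mem_nhds hx)
  have ha : ContDiffOn ℝ 1 (fun x => u x - c) Ω :=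
    (hu3.of_le (by norm_num)).sub contDiffOn_const
  have hb : ContDiffOn ℝ 1 (fun x => confDen K x ^ 2 * ∑ j, pderiv j u x ^ 2 + K * u x ^ 2
      - (K * c ^ 2 + c₂ ^ 2)) Ω := (contDiffOn_gradient_function hΩo hu3).sub contDiffOn_const
  -- The roles are a = u - c and b = P - c', with the bounded fields R = -2 Tₖ A X and Z = Tₖ X
  -- (weighted by √det g).
  refine setIntegral_divergence_eq_zero_of_combination (a := fun x => u x - c)
    (b := fun x => confDen K x ^ 2 * ∑ j, pderiv j u x ^ 2 + K * u x ^ 2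
      - (K * c ^ 2 + c₂ ^ 2))
    (W := boundaryField K c (K * c ^ 2 + c₂ ^ 2) s u k)
    (R := fun i x => (-2) * (s * newtonField K u 0 i x - newtonField K u (k + 1) i x))
    (Z := newtonField K u k) hΩo hΩb ha hb ?_
    (contDiffOn_boundaryField hΩo hq' hu3 c _ s k) (fun i x => ?_)
    (fun i => (ExtendsToClosure.const _).mul
      (((ExtendsToClosure.const s).mul (hZ 0 i)).sub (hZ (k + 1) i))) (hZ k) (fun i => ?_)
    (fun i => ?_) ?_ (fun x hx => sum_pderiv_boundaryField hΩo hq' hu3 hx c _ k (hs x hx)) ?_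
  · refine ⟨fun x => u x - c, fun x => confDen K x ^ 2 * ∑ j,
      fderivWithin ℝ u (closure Ω) x (EuclideanSpace.single j 1) ^ 2 + K * u x ^ 2
        - (K * c ^ 2 + c₂ ^ 2), hu2.continuousOn.sub continuousOn_const, ?_, fun _ _ => rfl, ?_, ?_⟩
    · refine (((contDiff_confDen (N := 0)).continuous.continuousOn.pow 2).mul
        (continuousOn_finsetSum _ fun j _ => ContinuousOn.pow ?_ 2)).add
        (continuousOn_const.mul (hu2.continuousOn.pow 2)) |>.sub continuousOn_const
      exact (contDiffOn_fderivWithin_closure (m := 0) hS hu2 (by norm_num) j).continuousOn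
    · intro x hx
      have : ∀ j, pderiv j u x = fderivWithin ℝ u (closure Ω) x (EuclideanSpace.single j 1) :=
        fun j => pderiv_eqOn_fderivWithin_closure hΩo (fun _ _ => rfl) j hx
      simp only [this]
    -- Here |∇u|² = c₂² and u = c on ∂Ω; this is why c' = K c² + c₂².
    · intro x hx
      have hxS := frontier_subset_closure hx
      have := sum_sq_fderivWithin_of_normal_derivative hΩo hx hΩ2 (hq x hxS)
        ((hu2 x hxS).differentiableWithinAt (by norm_num)) hD (hN x hx)
      simp only [this, hD x hx]
      constructor <;> ring
  · simp only [boundaryField]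
    ring
  · refine (h1 i).congr fun x hx => ?_
    have hd := (hud x hx).differentiableAt (by norm_num)
    exact HasLineDerivAt.pderiv_eq (((hd.hasLineDerivAt_pderiv i).fun_sub
      (HasLineDerivAt.fun_const c)).congr_val (sub_zero _)) (hd.sub_const c)
  · refine ((ExtendsToClosure.const 2).mul
      (extendsToClosure_hessianField_mulVec (K := K) hΩo hS hu2 i)).congr fun x hx => ?_
    exact HasLineDerivAt.pderiv_eq (((hasLineDerivAt_gradient_function
      ((hud x hx).of_le (by norm_num)) i).fun_sub
      (HasLineDerivAt.fun_const _)).congr_val (sub_zero _))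
      ((hb.contDiffAt (hΩo.mem_nhds hx)).differentiableAt one_ne_zero)
  · have hV : ExtendsToClosure Ω fun x => 1 - K * ‖x‖ ^ 2 / 4 :=
      ExtendsToClosure.of_continuousOn (Continuous.continuousOn (by fun_prop))
    exact (((extendsToClosure_inv_confDen hq).pow n).mul
      (hV.mul (extendsToClosure_inv_confDen hq))).mul
      (((ExtendsToClosure.const _).mul ((((ExtendsToClosure.confDen.pow 2).mul
        (ExtendsToClosure.sum fun j => (h1 j).pow 2)).add
        ((ExtendsToClosure.const K).mul (h0.pow 2))).sub (ExtendsToClosure.const _) |>.mul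
        (ExtendsToClosure.elemSymm_newtonTensor
          (extendsToClosure_hessianField hΩo hS hu2) k).1)).sub
        ((ExtendsToClosure.const _).mul (h0.sub (ExtendsToClosure.const c))))
  · intro x _ hax hbx
    rw [hax, hbx]
    ring

end SpaceFormIdentity

/-! ### The integral identity for the Riemannian volume -/

theorem lemma6p3 (n k : ℕ) (hk : 1 ≤ k) (hkn : k ≤ n) (K c₁ c₂ : ℝ)
    (hc₂ : 0 < c₂) (hc₁ : K ^ 2 * c₁ ≤ 1)
    -- `Ω` is a bounded domain of `Mⁿ(K)` with boundary of class `C²`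
    (Ω : Set (EuclideanSpace ℝ (Fin n))) (hΩM : Ω ⊆ spaceForm n K)
    (hΩo : IsOpen Ω) (hΩc : IsConnected Ω) (hΩb : ∃ R : ℝ, ∀ x ∈ Ω, radius K x ≤ R)
    (hΩ2 : HasC2Boundary Ω)
    -- `u ∈ C³(Ω) ∩ C²(closure Ω)` solves the overdetermined problem
    (u : EuclideanSpace ℝ (Fin n) → ℝ)
    (hu3 : ContDiffOn ℝ 3 u Ω) (hu2 : ContDiffOn ℝ 2 u (closure Ω))
    (heq : ∀ x ∈ Ω, sigmaHess (spaceFormMetric K) K k u x = (n.choose k : ℝ))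
    (hD : ∀ x ∈ frontier Ω, u x = K * c₁)
    (hN : ∀ x ∈ frontier Ω, ∀ ν, IsOutwardUnitNormal (spaceFormMetric K) Ω x ν →
      fderivWithin ℝ u (closure Ω) x ν = c₂)
    (hKu : ∀ x ∈ Ω, 0 ≤ K * u x) :
    IntegrableOn (fun x => (u x - K * c₁) * potentialV K x) Ω
      (riemVolume (spaceFormMetric K)) ∧
    IntegrableOn (fun x => (gradNormSq (spaceFormMetric K) u x + K * u x ^ 2
        - K ^ 3 * c₁ ^ 2 - c₂ ^ 2) * sigmaHess (spaceFormMetric K) K (k - 1) u x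
        * potentialV K x) Ω (riemVolume (spaceFormMetric K)) ∧
    (n.choose (k - 1) : ℝ) *
        ∫ x in Ω, (u x - K * c₁) * potentialV K x ∂(riemVolume (spaceFormMetric K)) =
      1 / 2 * ∫ x in Ω, (gradNormSq (spaceFormMetric K) u x + K * u x ^ 2
        - K ^ 3 * c₁ ^ 2 - c₂ ^ 2) * sigmaHess (spaceFormMetric K) K (k - 1) u x
        * potentialV K x ∂(riemVolume (spaceFormMetric K)) := by

  -- From here on σₖ₊₁ is the prescribed function and σₖ the weight, so no truncated subtraction
  -- remains in the orders.
  obtain ⟨k, rfl⟩ : ∃ m, k = m + 1 := ⟨k - 1, by omega⟩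
  rw [Nat.add_sub_cancel]
  obtain ⟨q₀, hq₀, hq₀'⟩ := exists_pos_le_confDen hΩM hΩb
  have hq : ∀ x ∈ closure Ω, 0 < confDen K x := fun x hx => hq₀.trans_le (hq₀' x hx)
  have hqΩ : ∀ x ∈ Ω, 0 < confDen K x := fun x hx => hq x (subset_closure hx)
  have hbdd := isBounded_of_radius_le hΩM hΩb
  have hS := uniqueDiffOn_closure_of_hasC2Boundary hΩo hΩ2
  have hud : ∀ x ∈ Ω, ContDiffAt ℝ 2 u x := fun x hx =>
    (hu3.contDiffAt (hΩo.mem_nhds hx)).of_le (by norm_num)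
  have hs : ∀ x ∈ Ω, elemSymm (k + 1) (hessianField K u x) = n.choose (k + 1) := fun x hx => by
    rw [← heq x hx, sigmaHess_eq_elemSymm hkn (hqΩ x hx).ne' (hud x hx)]
  have hid := setIntegral_coordinate_identity hΩo hbdd hΩ2 hq hu3 hu2 hs hD hN
  set ρ : EuclideanSpace ℝ (Fin n) → ℝ := fun x =>
    (confDen K x)⁻¹ ^ n * ((1 - K * ‖x‖ ^ 2 / 4) / confDen K x) with hρ
  set F₁ : EuclideanSpace ℝ (Fin n) → ℝ := fun x => ρ x * (u x - K * c₁) with hF₁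
  set F₂ : EuclideanSpace ℝ (Fin n) → ℝ := fun x => ρ x * ((confDen K x ^ 2 * ∑ j, pderiv j u x ^ 2
    + K * u x ^ 2 - (K * (K * c₁) ^ 2 + c₂ ^ 2)) * elemSymm k (hessianField K u x)) with hF₂
  have hext : ExtendsToClosure Ω ρ :=
    ((extendsToClosure_inv_confDen hq).pow n).mul ((ExtendsToClosure.of_continuousOn
      (Continuous.continuousOn (by fun_prop))).mul (extendsToClosure_inv_confDen hq))
  have h0 : ExtendsToClosure Ω u := ExtendsToClosure.of_continuousOn hu2.continuousOn
  have hI₁ : IntegrableOn F₁ Ω :=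
    (hext.mul (h0.sub (ExtendsToClosure.const _))).integrableOn hbdd hΩo
  have hI₂ : IntegrableOn F₂ Ω :=
    (hext.mul ((((ExtendsToClosure.confDen.pow 2).mul (ExtendsToClosure.sum fun j =>
      (extendsToClosure_pderiv hΩo hS hu2 j).pow 2)).add
      ((ExtendsToClosure.const K).mul (h0.pow 2))).sub (ExtendsToClosure.const _) |>.mul
      (ExtendsToClosure.elemSymm_newtonTensor
        (extendsToClosure_hessianField hΩo hS hu2) k).1)).integrableOn hbdd hΩo
  have e₁ : EqOn F₁ (fun x => (confDen K x)⁻¹ ^ n * ((u x - K * c₁) * potentialV K x)) Ω := by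
    intro x hx
    simp only [hF₁, hρ, potentialV_eq (hΩM hx)]
    ring
  have e₂ : EqOn F₂ (fun x => (confDen K x)⁻¹ ^ n * ((gradNormSq (spaceFormMetric K) u x
      + K * u x ^ 2 - K ^ 3 * c₁ ^ 2 - c₂ ^ 2) * sigmaHess (spaceFormMetric K) K k u x
      * potentialV K x)) Ω := by
    intro x hx
    simp only [hF₂, hρ, potentialV_eq (hΩM hx), gradNormSq_spaceForm (hqΩ x hx).ne',
      sigmaHess_eq_elemSymm ((Nat.le_succ k).trans hkn) (hqΩ x hx).ne' (hud x hx)]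
    ring
  refine ⟨integrableOn_riemVolume hΩo hqΩ (hI₁.congr_fun e₁ hΩo.measurableSet),
    integrableOn_riemVolume hΩo hqΩ (hI₂.congr_fun e₂ hΩo.measurableSet), ?_⟩
  rw [setIntegral_riemVolume hΩo hqΩ, setIntegral_riemVolume hΩo hqΩ,
    ← setIntegral_congr_fun hΩo.measurableSet e₁, ← setIntegral_congr_fun hΩo.measurableSet e₂]
  have hsplit : (n - k : ℝ) * ∫ x in Ω, F₂ x =
      2 * (k + 1) * n.choose (k + 1) * ∫ x in Ω, F₁ x := by
    rw [← integral_const_mul, ← integral_const_mul, ← sub_eq_zero,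
      ← integral_sub (hI₂.const_mul _) (hI₁.const_mul _), ← hid]
    refine setIntegral_congr_fun hΩo.measurableSet fun x _ => ?_
    simp only [hF₁, hF₂]
    ring
  have hchoose : ((k + 1 : ℝ)) * n.choose (k + 1) = (n - k) * n.choose k := by
    have := Nat.choose_succ_right_eq n k
    have h' : (n.choose (k + 1) : ℝ) * (k + 1) = n.choose k * ((n - k : ℕ) : ℝ) := by
      exact_mod_cast this
    rw [Nat.cast_sub ((Nat.le_succ k).trans hkn)] at h'
    linarith
  -- After the shift the order is k + 1 ≤ n, so n - k ≥ 1 even when the original order equals n.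
  have hnk : (n - k : ℝ) ≠ 0 := by
    have : (k : ℝ) + 1 ≤ n := by exact_mod_cast hkn
    linarith
  refine mul_left_cancel₀ hnk ?_
  rw [mul_left_comm _ (1 / 2 : ℝ), hsplit, mul_assoc 2, hchoose]
  ring
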